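/- Let $K$ be an infinite field, let $S=K[x_1,\ldots,x_n]$ with the standard grading, and let $\mathfrak m=(x_1,\ldots,x_n)$. For an $\mathfrak m$-primary graded ideal $I\subset S$ put $A=S/I=\bigoplus_{i\ge 0}A_i$. One says that $S/I$ has the weak Lefschetz property if there is a linear form $l\in A_1$ such that for every $i\in\mathbb N$ the multiplication map $A_i\to A_{i+1}$, $f\mapsto lf$, has maximal rank, that is, is injective or surjective. One says that $S/I$ has the strong Lefschetz property if there is a linear form $l\in A_1$ such that for all $i\in\mathbb N$ and all $k\ge 1$ the map $A_i\to A_{i+k}$, $f\mapsto l^kf$, is injective or surjective. Let $\operatorname{GL}_n(K)$ act on $S$ by linear substitutions, $g\,x_j=\sum_{i=1}^n g_{ij}x_i$, and let $\operatorname{in}(\cdot)$ denote the initial ideal with respect to the (degree) reverse lexicographic order with $x_1>x_2>\cdots>x_n$. The generic initial ideal of $I$ with respect to the reverse lexicographic order is the ideal $J$ such that $\operatorname{in}(gI)=J$ for all $g$ in some nonempty Zariski-open subset of $\operatorname{GL}_n(K)$. Proposition. Let $I\subset S$ be an $\mathfrak m$-primary graded ideal and let $J$ be the generic initial ideal of $I$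 with respect to the reverse lexicographic order. Then $S/I$ has the weak Lefschetz property if and only if $S/J$ has the weak Lefschetz property, and $S/I$ has the strong Lefschetz property if and only if $S/J$ has the strong Lefschetz property. -/

import Mathlib

attribute [local instance] MvPolynomial.gradedAlgebra

namespace GinLefschetz

open MvPolynomial

/-! ### The (degree) reverse lexicographic order -/

/-- Exponent vectors of monomials in `x_1, …, x_n` (the variable `x_{i+1}` of the mathematics is
`X i`, `i : Fin n`), to be ordered by the degree reverse lexicographic order. -/
def RevLex (n : ℕ) : Type := Fin n →₀ ℕ

noncomputable instance (n : ℕ) : AddCommMonoid (RevLex n) :=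
  inferInstanceAs (AddCommMonoid (Fin n →₀ ℕ))

/-- The identification of `RevLex n` with the additive monoid of exponent vectors. -/
noncomputable def RevLex.exps {n : ℕ} : RevLex n ≃+ (Fin n →₀ ℕ) where
  toFun a := a
  invFun a := a
  map_add' _ _ := rfl

/-- First compare the degrees; then compare the exponents colexicographically (that is, at the last
variable where they differ) and reverse the result. -/
noncomputable def RevLex.key {n : ℕ} (a : RevLex n) : ℕ ×ₗ (Colex (Fin n →₀ ℕ))ᵒᵈ :=
  toLex ((RevLex.exps a).degree, OrderDual.toDual (toColex (RevLex.exps a)))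

theorem RevLex.key_injective {n : ℕ} : Function.Injective (RevLex.key (n := n)) := by
  intro a b h
  exact RevLex.exps.injective
    (congrArg (fun x => ofColex (OrderDual.ofDual (ofLex x).2)) h)

noncomputable instance (n : ℕ) : LinearOrder (RevLex n) :=
  LinearOrder.lift' RevLex.key RevLex.key_injective

/-- `x^a < x^b` iff `deg x^a < deg x^b`, or the degrees agree and, at the last variable at which the
exponents differ, `x^a` has the larger exponent. In particular `x_1 > x_2 > ⋯ > x_n`. -/
theorem RevLex.lt_iff {n : ℕ} {a b : RevLex n} :
    a < b ↔ (RevLex.exps a).degree < (RevLex.exps b).degree ∨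
      ((RevLex.exps a).degree = (RevLex.exps b).degree ∧
      ∃ i, (∀ j, i < j → RevLex.exps a j = RevLex.exps b j) ∧ RevLex.exps b i < RevLex.exps a i) := by
  change RevLex.key a < RevLex.key b ↔ _
  unfold RevLex.key
  rw [Prod.Lex.toLex_lt_toLex]
  refine or_congr Iff.rfl (and_congr Iff.rfl ?_)
  rw [OrderDual.toDual_lt_toDual, Finsupp.Colex.lt_iff]
  simp [eq_comm]

theorem RevLex.exps_add {n : ℕ} (a b : RevLex n) :
    RevLex.exps (a + b) = RevLex.exps a + RevLex.exps b := rfl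

theorem RevLex.add_lt_add_left {n : ℕ} {a b : RevLex n} (h : a < b) (c : RevLex n) :
    a + c < b + c := by
  rw [RevLex.lt_iff] at h ⊢
  simpa [RevLex.exps_add] using h

instance (n : ℕ) : IsOrderedAddMonoid (RevLex n) where
  add_le_add_left a b h c := by
    rcases h.lt_or_eq with h | h
    · exact (RevLex.add_lt_add_left h c).le
    · rw [h]

theorem RevLex.monotone {n : ℕ} {a b : RevLex n} (h : RevLex.exps a ≤ RevLex.exps b) : a ≤ b := by
  rcases h.lt_or_eq with h | h
  · refine le_of_lt (RevLex.lt_iff.2 (Or.inl ?_))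
    obtain ⟨c, hc⟩ := exists_add_of_le h.le
    have hc0 : c ≠ 0 := by
      rintro rfl
      simp only [add_zero] at hc
      exact h.ne hc.symm
    have : c.degree ≠ 0 := fun h0 => hc0 ((Finsupp.degree_eq_zero_iff c).1 h0)
    rw [hc, map_add]
    lia
  · exact le_of_eq (RevLex.exps.injective h)

instance (n : ℕ) : WellFoundedLT (RevLex n) := by
  refine ⟨?_⟩
  have hfin : ∀ d : ℕ, {a : RevLex n | (RevLex.exps a).degree ≤ d}.Finite := fun d => by
    refine (Set.finite_Iic (Finsupp.equivFunOnFinite.symm (fun _ : Fin n => d))).subset ?_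
    intro a ha i
    exact (Finsupp.le_degree i (RevLex.exps a)).trans ha
  rw [← Set.wellFoundedOn_univ, Set.wellFoundedOn_iff_no_descending_seq]
  intro f _
  have hle : ∀ k, (RevLex.exps (f k)).degree ≤ (RevLex.exps (f 0)).degree := by
    intro k
    have : f k ≤ f 0 := by
      rcases Nat.eq_zero_or_pos k with rfl | hk
      · exact le_rfl
      · exact le_of_lt (f.map_rel_iff.2 hk)
    rcases this.lt_or_eq with h | h
    · rcases RevLex.lt_iff.1 h with h | h
      · exact h.le
      · exact h.1.le
    · rw [h]
  exact Set.infinite_range_of_injective f.injective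
    ((hfin (RevLex.exps (f 0)).degree).subset (by rintro _ ⟨k, rfl⟩; exact hle k))

/-- The degree reverse lexicographic order on the monomials in `n` variables, with
`x_1 > x_2 > ⋯ > x_n`. -/
noncomputable def revLex (n : ℕ) : MonomialOrder (Fin n) where
  syn := RevLex n
  toSyn := RevLex.exps.symm
  toSyn_monotone a b h :=
    RevLex.monotone (a := RevLex.exps.symm a) (b := RevLex.exps.symm b) (by
      rwa [AddEquiv.apply_symm_apply, AddEquiv.apply_symm_apply])

theorem revLex_lt_iff {n : ℕ} {a b : Fin n →₀ ℕ} :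
    (revLex n).toSyn a < (revLex n).toSyn b ↔ a.degree < b.degree ∨ (a.degree = b.degree ∧
      ∃ i, (∀ j, i < j → a j = b j) ∧ b i < a i) :=
  RevLex.lt_iff (a := RevLex.exps.symm a) (b := RevLex.exps.symm b)

/-! ### Generic initial ideals -/

variable {K : Type*} [Field K] {n : ℕ}

/-- The initial ideal `in(I)` with respect to a monomial order: the ideal generated by the
leading terms of the elements of `I`. -/
noncomputable def initialIdeal (m : MonomialOrder (Fin n)) (I : Ideal (MvPolynomial (Fin n) K)) :
    Ideal (MvPolynomial (Fin n) K) :=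
  Ideal.span (m.leadingTerm '' (I : Set (MvPolynomial (Fin n) K)))

/-- The action of `g ∈ GL_n(K)` on `K[x_1, …, x_n]` by linear substitutions,
`g x_j = ∑ i, g_{ij} x_i`. -/
noncomputable def glAct (g : GL (Fin n) K) : MvPolynomial (Fin n) K →ₐ[K] MvPolynomial (Fin n) K :=
  aeval fun j => ∑ i, C (g.val i j) * X i

theorem glAct_one : glAct (1 : GL (Fin n) K) = AlgHom.id K _ := by
  ext j : 1
  simp [glAct, Matrix.one_apply]

/-- `glAct` is a left action. -/
theorem glAct_mul (g h : GL (Fin n) K) : glAct (g * h) = (glAct g).comp (glAct h) := by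
  ext j : 1
  simp only [glAct, aeval_X, AlgHom.comp_apply, map_sum, map_mul, algHom_C, algebraMap_eq,
    Units.val_mul, Matrix.mul_apply, Finset.sum_mul, Finset.mul_sum]
  rw [Finset.sum_comm]
  refine Finset.sum_congr rfl fun i _ => Finset.sum_congr rfl fun k _ => ?_
  ring

/-- The ideal `gI`; since `glAct g` is bijective, this is the image of `I`. -/
noncomputable def glIdeal (g : GL (Fin n) K) (I : Ideal (MvPolynomial (Fin n) K)) :
    Ideal (MvPolynomial (Fin n) K) :=
  I.map (glAct g)

/-- Zariski-open subsets of `GL_n(K)`: the complements of the common zero loci of sets of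
polynomials in the `n²` matrix entries. -/
def IsZariskiOpen (U : Set (GL (Fin n) K)) : Prop :=
  ∃ P : Set (MvPolynomial (Fin n × Fin n) K),
    ∀ g : GL (Fin n) K, g ∈ U ↔ ∃ p ∈ P, eval (fun ij => g.val ij.1 ij.2) p ≠ 0

/-- `J` is the generic initial ideal of `I` with respect to the monomial order `m`:
`in(gI) = J` for all `g` in some nonempty Zariski-open subset of `GL_n(K)`. -/
def IsGenericInitialIdeal (m : MonomialOrder (Fin n)) (I J : Ideal (MvPolynomial (Fin n) K)) :
    Prop :=
  ∃ U : Set (GL (Fin n) K), IsZariskiOpen U ∧ U.Nonempty ∧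
    ∀ g ∈ U, initialIdeal m (glIdeal g I) = J

/-! ### The Lefschetz properties -/

/-- The homogeneous component `(S/I)_i` of the quotient of the polynomial ring by a graded ideal:
the residue classes of the forms of degree `i`. -/
noncomputable def quotientComponent (I : Ideal (MvPolynomial (Fin n) K)) (i : ℕ) :
    Submodule K (MvPolynomial (Fin n) K ⧸ I) :=
  (homogeneousSubmodule (Fin n) K i).map (Ideal.Quotient.mkₐ K I).toLinearMap

/-- For graded `A = S/I`, multiplication by `l ^ k`, as a map `A_i → A_{i+k}` (for `l ∈ A_1`), has
maximal rank, i.e. is injective or surjective. -/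
def MulPowHasMaxRank (I : Ideal (MvPolynomial (Fin n) K)) (l : MvPolynomial (Fin n) K ⧸ I)
    (k i : ℕ) : Prop :=
  Set.InjOn (fun f => l ^ k * f) (quotientComponent I i : Set (MvPolynomial (Fin n) K ⧸ I)) ∨
    Set.SurjOn (fun f => l ^ k * f) (quotientComponent I i : Set (MvPolynomial (Fin n) K ⧸ I))
      (quotientComponent I (i + k))

/-- `S/I` has the weak Lefschetz property. -/
def HasWeakLefschetz (I : Ideal (MvPolynomial (Fin n) K)) : Prop :=
  ∃ l ∈ quotientComponent I 1, ∀ i : ℕ, MulPowHasMaxRank I l 1 i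

/-- `S/I` has the strong Lefschetz property. -/
def HasStrongLefschetz (I : Ideal (MvPolynomial (Fin n) K)) : Prop :=
  ∃ l ∈ quotientComponent I 1, ∀ i k : ℕ, 1 ≤ k → MulPowHasMaxRank I l k i

end GinLefschetz

/-!
Write `x` for the last variable, and let `J` be the initial ideal of `gI` for `g` in the open set
that defines the generic initial ideal. Both implications compare maximal rank of a power of a
linear form modulo `gI` and modulo `J`, and use that maximal rank is an open condition on the
linear form. The latter is seen as follows (`IsAdapted.maxRankOnForms_iff`): if the forms `u`
represent a basis of `(S/I)_i` and the forms `f` are a basis of `I_{i+k}`, then multiplication by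
`l ^ k` is injective, resp. surjective, iff the forms `l ^ k * u` together with `f` are linearly
independent, resp. span all forms of degree `i + k`. Either condition persists on a basic open set
when the family depends polynomially on parameters (`exists_forall_linearIndependent`,
`exists_forall_span_eq`). As `I` contains all forms of large degree, only finitely many pairs
`(i, k)` matter, and since `K` is infinite one generic linear form serves for all of them
(`exists_ne_zero_forall_maxRankOnForms`).

From `I` to `J`: if `S/I` has a Lefschetz element, then a generic linear form is one, hence for
generic `g` the preimage of `x` under `g` is one, so that `x` is a Lefschetz element modulo `gI`.
Because a monomial not divisible by `x ^ k` is larger in the reverse lexicographic order than any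
monomial of the same degree that is, both injectivity and surjectivity of `x ^ k` pass from `gI`
to its initial ideal (`MaxRankOnForms.initialIdeal_X_last`).

From `J` to `I`: the ideal `J` is the limit of the ideals `t • gI` under a one-parameter group of
diagonal matrices whose weights realize the reverse lexicographic order in bounded degrees:
by Macaulay's theorem the standard monomials and the triangular basis of `gI`, suitably rescaled,
form a family over `K[t]` that specializes at `0` to the corresponding bases for `J`
(`isAdapted_of_isMonicForm`, `map_weightDeform_zero`, `map_weightDeform_unit`). By openness a
linear form of maximal rank modulo `J` has maximal rank modulo `t • gI` for some `t ≠ 0`, and can be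
moved back to `I` (`exists_maxRankOnForms_of_initialIdeal`). This argument works for any linear
form, so Borel-fixedness of the generic initial ideal is not needed.
-/

namespace GinLefschetz

open MvPolynomial

/-! ### Spreading out independence and spanning -/

section SpreadingOut

variable {K : Type*} [Field K] {n : ℕ}

instance finite_degree_eq (d : ℕ) : Finite {a : Fin n →₀ ℕ // a.degree = d} :=
  ((Set.finite_Iic (Finsupp.equivFunOnFinite.symm fun _ : Fin n => d)).subset
    fun a (ha : a.degree = d) i => (Finsupp.le_degree i a).trans ha.le).to_subtype

/-- The matrix of coefficients of a family of forms of degree `d`; its rows are indexed by the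
monomials of degree `d`. -/
def coeffMatrix {R ι : Type*} [CommRing R] (d : ℕ) (F : ι → MvPolynomial (Fin n) R) :
    Matrix {a : Fin n →₀ ℕ // a.degree = d} ι R :=
  Matrix.of fun a j => coeff a.1 (F j)

theorem coeffMatrix_mulVec_eq_iff {ι : Type*} [Fintype ι] {d : ℕ} {F : ι → MvPolynomial (Fin n) K}
    (hF : ∀ j, (F j).IsHomogeneous d) (c : ι → K) {f : MvPolynomial (Fin n) K}
    (hf : f.IsHomogeneous d) :
    (coeffMatrix d F).mulVec c = (fun a => coeff a.1 f) ↔ ∑ j, c j • F j = f := by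
  have key : ∀ a : Fin n →₀ ℕ, coeff a (∑ j, c j • F j) = ∑ j, coeff a (F j) * c j := by
    intro a
    simp [coeff_sum, mul_comm]
  constructor
  · intro h
    ext a
    by_cases ha : a.degree = d
    · rw [key]
      exact congrFun h ⟨a, ha⟩
    · rw [key, hf.coeff_eq_zero ha]
      exact Finset.sum_eq_zero fun j _ => by rw [(hF j).coeff_eq_zero ha, zero_mul]
  · rintro rfl
    funext a
    rw [key]
    rfl

theorem coeffMatrix_map {R ι : Type*} [CommRing R] (d : ℕ) (F : ι → MvPolynomial (Fin n) R)
    (φ : R →+* K) :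
    coeffMatrix d (fun j => map φ (F j)) = (coeffMatrix d F).map φ := by
  ext a j
  simp [coeffMatrix, coeff_map]

/-- Every vector indexed by monomials of degree `d` is the coefficient vector of a form. -/
theorem exists_isHomogeneous_coeff_eq {d : ℕ} (v : {a : Fin n →₀ ℕ // a.degree = d} → K) :
    ∃ f : MvPolynomial (Fin n) K, f.IsHomogeneous d ∧ v = fun a => coeff a.1 f := by
  classical
  have := Fintype.ofFinite {a : Fin n →₀ ℕ // a.degree = d}
  refine ⟨∑ a, monomial a.1 (v a), IsHomogeneous.sum _ _ _ fun a _ =>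
    isHomogeneous_monomial _ a.2, ?_⟩
  funext b
  simp [coeff_sum, coeff_monomial, Subtype.val_inj]

theorem linearIndependent_iff_coeffMatrix {ι : Type*} [Fintype ι] {d : ℕ}
    {F : ι → MvPolynomial (Fin n) K} (hF : ∀ j, (F j).IsHomogeneous d) :
    LinearIndependent K F ↔ Function.Injective (coeffMatrix d F).mulVec := by
  rw [Fintype.linearIndependent_iff, ← Matrix.coe_mulVecLin, injective_iff_map_eq_zero]
  refine forall_congr' fun c => ?_
  rw [← coeffMatrix_mulVec_eq_iff hF c (isHomogeneous_zero _ _ d), funext_iff (f := c)]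
  rfl

theorem span_eq_iff_coeffMatrix {ι : Type*} [Fintype ι] {d : ℕ}
    {F : ι → MvPolynomial (Fin n) K} (hF : ∀ j, (F j).IsHomogeneous d) :
    Submodule.span K (Set.range F) = homogeneousSubmodule (Fin n) K d ↔
      Function.Surjective (coeffMatrix d F).mulVec := by
  have hle : Submodule.span K (Set.range F) ≤ homogeneousSubmodule (Fin n) K d := by
    rw [Submodule.span_le]
    rintro _ ⟨j, rfl⟩
    exact hF j
  constructor
  · intro h v
    obtain ⟨f, hf, rfl⟩ := exists_isHomogeneous_coeff_eq v
    have hf' : f ∈ Submodule.span K (Set.range F) := h ▸ hf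
    obtain ⟨c, hc⟩ := (Submodule.mem_span_range_iff_exists_fun K).1 hf'
    exact ⟨c, (coeffMatrix_mulVec_eq_iff hF c hf).2 hc⟩
  · refine fun h => le_antisymm hle fun f hf => ?_
    obtain ⟨c, hc⟩ := h fun a => coeff a.1 f
    exact (Submodule.mem_span_range_iff_exists_fun K).2
      ⟨c, (coeffMatrix_mulVec_eq_iff hF c hf).1 hc⟩

variable {R ι : Type*} [CommRing R] [Algebra K R] [Finite ι] {d : ℕ}
  {F : ι → MvPolynomial (Fin n) R}

/-- Linear independence at one `K`-point `φ₀` of `Spec R` spreads to a basic open neighbourhood. -/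
theorem exists_forall_linearIndependent (hF : ∀ j, (F j).IsHomogeneous d) (φ₀ : R →ₐ[K] K)
    (h : LinearIndependent K fun j => map (φ₀ : R →+* K) (F j)) :
    ∃ p : R, φ₀ p ≠ 0 ∧ ∀ φ : R →ₐ[K] K, φ p ≠ 0 →
      LinearIndependent K fun j => map (φ : R →+* K) (F j) := by
  classical
  have := Fintype.ofFinite ι
  have := Fintype.ofFinite {a : Fin n →₀ ℕ // a.degree = d}
  have hom : ∀ φ : R →ₐ[K] K, ∀ j, (map (φ : R →+* K) (F j)).IsHomogeneous d :=
    fun φ j => (hF j).map _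
  rw [linearIndependent_iff_coeffMatrix (hom φ₀), coeffMatrix_map] at h
  set M := coeffMatrix d F
  -- a left inverse of the matrix at `φ₀` turns independence into invertibility of a square matrix
  obtain ⟨L, hL⟩ : ∃ L : Matrix ι {a : Fin n →₀ ℕ // a.degree = d} K, L * M.map φ₀ = 1 := by
    obtain ⟨g, hg⟩ := LinearMap.exists_leftInverse_of_injective
      (Matrix.toLin' (M.map φ₀)) (LinearMap.ker_eq_bot.2 h)
    refine ⟨LinearMap.toMatrix' g, ?_⟩
    rw [← LinearMap.toMatrix'_toLin' (M.map φ₀), ← LinearMap.toMatrix'_comp, hg,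
      LinearMap.toMatrix'_id]
  have hdet : ∀ φ : R →ₐ[K] K,
      φ ((L.map (algebraMap K R) * M).det) = (L * M.map φ).det := by
    intro φ
    rw [AlgHom.map_det]
    congr 1
    ext a b
    simp [Matrix.mul_apply]
  refine ⟨(L.map (algebraMap K R) * M).det, ?_, fun φ hφ => ?_⟩
  · rw [hdet, hL, Matrix.det_one]
    exact one_ne_zero
  · rw [linearIndependent_iff_coeffMatrix (hom φ), coeffMatrix_map]
    rw [hdet] at hφ
    have hinj := Matrix.mulVec_injective_of_isUnit
      ((Matrix.isUnit_iff_isUnit_det _).2 hφ.isUnit)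
    intro v w hvw
    apply hinj
    rw [← Matrix.mulVec_mulVec, ← Matrix.mulVec_mulVec]
    exact congrArg _ hvw

/-- Spanning all forms of degree `d` at one `K`-point `φ₀` of `Spec R` spreads to a basic open
neighbourhood. -/
theorem exists_forall_span_eq (hF : ∀ j, (F j).IsHomogeneous d) (φ₀ : R →ₐ[K] K)
    (h : Submodule.span K (Set.range fun j => map (φ₀ : R →+* K) (F j)) =
      homogeneousSubmodule (Fin n) K d) :
    ∃ p : R, φ₀ p ≠ 0 ∧ ∀ φ : R →ₐ[K] K, φ p ≠ 0 →
      Submodule.span K (Set.range fun j => map (φ : R →+* K) (F j)) =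
        homogeneousSubmodule (Fin n) K d := by
  classical
  have := Fintype.ofFinite ι
  have := Fintype.ofFinite {a : Fin n →₀ ℕ // a.degree = d}
  have hom : ∀ φ : R →ₐ[K] K, ∀ j, (map (φ : R →+* K) (F j)).IsHomogeneous d :=
    fun φ j => (hF j).map _
  rw [span_eq_iff_coeffMatrix (hom φ₀), coeffMatrix_map] at h
  set M := coeffMatrix d F
  obtain ⟨L, hL⟩ := Matrix.mulVec_surjective_iff_exists_right_inverse.1 h
  have hdet : ∀ φ : R →ₐ[K] K,
      φ ((M * L.map (algebraMap K R)).det) = (M.map φ * L).det := by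
    intro φ
    rw [AlgHom.map_det]
    congr 1
    ext a b
    simp [Matrix.mul_apply]
  refine ⟨(M * L.map (algebraMap K R)).det, ?_, fun φ hφ => ?_⟩
  · rw [hdet]
    erw [hL]
    rw [Matrix.det_one]
    exact one_ne_zero
  · rw [span_eq_iff_coeffMatrix (hom φ), coeffMatrix_map]
    rw [hdet] at hφ
    have hsurj := Matrix.mulVec_surjective_iff_isUnit.2
      ((Matrix.isUnit_iff_isUnit_det _).2 hφ.isUnit)
    intro v
    obtain ⟨w, hw⟩ := hsurj v
    exact ⟨L.mulVec w, by rw [← hw]; exact Matrix.mulVec_mulVec _ _ _⟩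

end SpreadingOut

/-! ### Maximal rank in terms of forms -/

section MaxRank

variable {K : Type*} [Field K] {n : ℕ} {I : Ideal (MvPolynomial (Fin n) K)}

/-- Multiplication by `l ^ k` from forms of degree `i` to forms of degree `i + k` is injective or
surjective modulo `I`. -/
def MaxRankOnForms (I : Ideal (MvPolynomial (Fin n) K)) (l : MvPolynomial (Fin n) K)
    (k i : ℕ) : Prop :=
  (∀ f, f.IsHomogeneous i → l ^ k * f ∈ I → f ∈ I) ∨
    ∀ f, f.IsHomogeneous (i + k) → ∃ h, h.IsHomogeneous i ∧ f - l ^ k * h ∈ I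

theorem mulPowHasMaxRank_mk_iff {l : MvPolynomial (Fin n) K} (k i : ℕ) :
    MulPowHasMaxRank I (Ideal.Quotient.mk I l) k i ↔ MaxRankOnForms I l k i := by
  refine or_congr ⟨fun h f hf hlf => ?_, fun h => ?_⟩ ⟨fun h f hf => ?_, fun h => ?_⟩
  · have h0 : Ideal.Quotient.mk I f = 0 := by
      refine h (x₁ := Ideal.Quotient.mk I f) ⟨f, hf, rfl⟩ (Submodule.zero_mem _) ?_
      simpa [← map_pow, ← map_mul] using Ideal.Quotient.eq_zero_iff_mem.2 hlf
    exact Ideal.Quotient.eq_zero_iff_mem.1 h0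
  · rintro _ ⟨f, hf, rfl⟩ _ ⟨g, hg, rfl⟩ hfg
    refine Ideal.Quotient.eq.2 (h _ (IsHomogeneous.sub hf hg) ?_)
    rw [mul_sub]
    refine Ideal.Quotient.eq.1 ?_
    simpa using hfg
  · obtain ⟨_, ⟨h, hh, rfl⟩, hfh⟩ := h (a := Ideal.Quotient.mk I f) ⟨f, hf, rfl⟩
    refine ⟨h, hh, Ideal.Quotient.eq.1 ?_⟩
    simpa using hfh.symm
  · rintro _ ⟨f, hf, rfl⟩
    obtain ⟨g, hg, hfg⟩ := h f hf
    refine ⟨Ideal.Quotient.mk I g, ⟨g, hg, rfl⟩, ?_⟩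
    have := (Ideal.Quotient.eq.2 hfg).symm
    simpa using this

theorem exists_mem_quotientComponent_one_iff {P : ℕ → ℕ → Prop} :
    (∃ l ∈ quotientComponent I 1, ∀ i k, P i k → MulPowHasMaxRank I l k i) ↔
      ∃ l : MvPolynomial (Fin n) K, l.IsHomogeneous 1 ∧
        ∀ i k, P i k → MaxRankOnForms I l k i := by
  constructor
  · rintro ⟨_, ⟨l, hl, rfl⟩, h⟩
    exact ⟨l, hl, fun i k hik => (mulPowHasMaxRank_mk_iff k i).1 (h i k hik)⟩
  · rintro ⟨l, hl, h⟩
    exact ⟨Ideal.Quotient.mk I l, ⟨l, hl, rfl⟩,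
      fun i k hik => (mulPowHasMaxRank_mk_iff k i).2 (h i k hik)⟩

theorem MaxRankOnForms.smul {l : MvPolynomial (Fin n) K} {k i : ℕ} (h : MaxRankOnForms I l k i)
    {c : K} (hc : c ≠ 0) : MaxRankOnForms I (c • l) k i := by
  rcases h with h | h
  · refine Or.inl fun f hf hlf => h f hf ?_
    rw [smul_pow, smul_mul_assoc] at hlf
    have := I.mul_mem_left (C (c ^ k)⁻¹) hlf
    rwa [← smul_eq_C_mul, smul_smul, inv_mul_cancel₀ (pow_ne_zero k hc), one_smul] at this
  · refine Or.inr fun f hf => ?_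
    obtain ⟨g, hg, hfg⟩ := h f hf
    refine ⟨(c ^ k)⁻¹ • g, (homogeneousSubmodule (Fin n) K i).smul_mem _ hg, ?_⟩
    rwa [smul_pow, smul_mul_smul_comm, mul_inv_cancel₀ (pow_ne_zero k hc), one_smul]

theorem glAct_isHomogeneous (g : GL (Fin n) K) {f : MvPolynomial (Fin n) K} {d : ℕ}
    (hf : f.IsHomogeneous d) : (glAct g f).IsHomogeneous d := by
  have := hf.aeval (fun j => ∑ i, C (g.val i j) * X i) (n := 1)
    fun j => IsHomogeneous.sum _ _ _ fun i _ => isHomogeneous_C_mul_X _ _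
  rwa [one_mul] at this

theorem glAct_inv_apply (g : GL (Fin n) K) (f : MvPolynomial (Fin n) K) :
    glAct g⁻¹ (glAct g f) = f := by
  rw [← AlgHom.comp_apply, ← glAct_mul, inv_mul_cancel, glAct_one, AlgHom.id_apply]

theorem glAct_apply_inv (g : GL (Fin n) K) (f : MvPolynomial (Fin n) K) :
    glAct g (glAct g⁻¹ f) = f := by
  rw [← AlgHom.comp_apply, ← glAct_mul, mul_inv_cancel, glAct_one, AlgHom.id_apply]

theorem mem_glIdeal_iff {g : GL (Fin n) K} {f : MvPolynomial (Fin n) K} :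
    f ∈ glIdeal g I ↔ glAct g⁻¹ f ∈ I := by
  refine ⟨fun h => ?_, fun h => ?_⟩
  · have hle : glIdeal g I ≤ I.comap (glAct g⁻¹) := by
      refine Ideal.map_le_iff_le_comap.2 fun x hx => ?_
      simpa [glAct_inv_apply] using hx
    exact hle h
  · have := Ideal.mem_map_of_mem (glAct g) h
    rwa [glAct_apply_inv] at this

theorem glIdeal_inv_glIdeal (g : GL (Fin n) K) (I : Ideal (MvPolynomial (Fin n) K)) :
    glIdeal g⁻¹ (glIdeal g I) = I := by
  ext f
  rw [mem_glIdeal_iff, mem_glIdeal_iff, inv_inv, glAct_inv_apply]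

theorem MaxRankOnForms.glAct {l : MvPolynomial (Fin n) K} {k i : ℕ} (h : MaxRankOnForms I l k i)
    (g : GL (Fin n) K) : MaxRankOnForms (glIdeal g I) (glAct g l) k i := by
  rcases h with h | h
  · refine Or.inl fun f hf hlf => ?_
    rw [mem_glIdeal_iff] at hlf ⊢
    rw [map_mul, map_pow, glAct_inv_apply] at hlf
    exact h _ (glAct_isHomogeneous _ hf) hlf
  · refine Or.inr fun f hf => ?_
    obtain ⟨q, hq, hfq⟩ := h _ (glAct_isHomogeneous g⁻¹ hf)
    refine ⟨GinLefschetz.glAct g q, glAct_isHomogeneous _ hq, ?_⟩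
    rwa [mem_glIdeal_iff, map_sub, map_mul, map_pow, glAct_inv_apply, glAct_inv_apply]

theorem isHomogeneous_glIdeal (hI : I.IsHomogeneous (homogeneousSubmodule (Fin n) K))
    (g : GL (Fin n) K) : (glIdeal g I).IsHomogeneous (homogeneousSubmodule (Fin n) K) := by
  obtain ⟨s, rfl⟩ := (Ideal.IsHomogeneous.iff_exists _ I).1 hI
  rw [glIdeal, Ideal.map_span]
  refine Ideal.homogeneous_span _ _ ?_
  rintro _ ⟨_, ⟨⟨x, d, hd⟩, -, rfl⟩, rfl⟩
  exact ⟨d, glAct_isHomogeneous g hd⟩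

end MaxRank

/-! ### Adapted bases -/

section Adapted

variable {K : Type*} [Field K] {n : ℕ} {I : Ideal (MvPolynomial (Fin n) K)} {i k d : ℕ}
  {ι₁ ι₂ : Type*} [Fintype ι₁]

/-- The forms `u` of degree `i` represent a basis of `(S/I)_i`, and the forms `f` are a basis
of `I_d`. -/
structure IsAdapted (I : Ideal (MvPolynomial (Fin n) K)) (i d : ℕ)
    (u : ι₁ → MvPolynomial (Fin n) K) (f : ι₂ → MvPolynomial (Fin n) K) : Prop where
  isHomogeneous : ∀ j, (u j).IsHomogeneous i
  exists_sub_mem : ∀ q : MvPolynomial (Fin n) K, q.IsHomogeneous i →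
    ∃ c : ι₁ → K, q - ∑ j, c j • u j ∈ I
  eq_zero_of_sum_mem : ∀ c : ι₁ → K, ∑ j, c j • u j ∈ I → c = 0
  linearIndependent : LinearIndependent K f
  span_eq : Submodule.span K (Set.range f) =
    I.restrictScalars K ⊓ homogeneousSubmodule (Fin n) K d

/-- The forms `l ^ k * u j` together with the forms `f j`. Modulo the span of the latter, this is
the image of the basis `u` under multiplication by `l ^ k`. -/
noncomputable def mulFamily {R ι₁ ι₂ : Type*} [CommRing R] (l : MvPolynomial (Fin n) R) (k : ℕ)
    (u : ι₁ → MvPolynomial (Fin n) R) (f : ι₂ → MvPolynomial (Fin n) R) :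
    ι₁ ⊕ ι₂ → MvPolynomial (Fin n) R :=
  Sum.elim (fun j => l ^ k * u j) f

theorem map_mulFamily {R ι₁ ι₂ : Type*} [CommRing R] (φ : R →+* K) (l : MvPolynomial (Fin n) R)
    (k : ℕ) (u : ι₁ → MvPolynomial (Fin n) R) (f : ι₂ → MvPolynomial (Fin n) R) :
    (fun j => map φ (mulFamily l k u f j)) =
      mulFamily (map φ l) k (fun j => map φ (u j)) (fun j => map φ (f j)) := by
  funext j
  rcases j with j | j <;> simp [mulFamily]

theorem mulFamily_isHomogeneous {R ι₁ ι₂ : Type*} [CommRing R] {l : MvPolynomial (Fin n) R}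
    {u : ι₁ → MvPolynomial (Fin n) R} {f : ι₂ → MvPolynomial (Fin n) R}
    (hl : l.IsHomogeneous 1) (hu : ∀ j, (u j).IsHomogeneous i)
    (hf : ∀ j, (f j).IsHomogeneous (i + k)) (j : ι₁ ⊕ ι₂) :
    (mulFamily l k u f j).IsHomogeneous (i + k) := by
  rcases j with j | j
  · have := (hl.pow k).mul (hu j)
    rwa [one_mul, add_comm] at this
  · exact hf j

theorem IsAdapted.mem {u : ι₁ → MvPolynomial (Fin n) K} {f : ι₂ → MvPolynomial (Fin n) K}
    (h : IsAdapted I i d u f) (j : ι₂) : f j ∈ I ∧ (f j).IsHomogeneous d := by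
  have : f j ∈ I.restrictScalars K ⊓ homogeneousSubmodule (Fin n) K d :=
    h.span_eq ▸ Submodule.subset_span ⟨j, rfl⟩
  exact this

variable [Fintype ι₂]

theorem IsAdapted.exists_eq {u : ι₁ → MvPolynomial (Fin n) K} {f : ι₂ → MvPolynomial (Fin n) K}
    (h : IsAdapted I i d u f) {q : MvPolynomial (Fin n) K} (hq : q ∈ I)
    (hqd : q.IsHomogeneous d) : ∃ e : ι₂ → K, ∑ j, e j • f j = q := by
  refine (Submodule.mem_span_range_iff_exists_fun K).1 ?_
  rw [h.span_eq]
  exact ⟨hq, hqd⟩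

theorem IsAdapted.maxRankOnForms_iff {u : ι₁ → MvPolynomial (Fin n) K}
    {f : ι₂ → MvPolynomial (Fin n) K} (h : IsAdapted I i (i + k) u f)
    {l : MvPolynomial (Fin n) K} (hl : l.IsHomogeneous 1) :
    MaxRankOnForms I l k i ↔ LinearIndependent K (mulFamily l k u f) ∨
      Submodule.span K (Set.range (mulFamily l k u f)) =
        homogeneousSubmodule (Fin n) K (i + k) := by
  have hf := h.mem
  have hom : ∀ q : MvPolynomial (Fin n) K, q.IsHomogeneous i →
      (l ^ k * q).IsHomogeneous (i + k) := fun q hq => by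
    have := (hl.pow k).mul hq
    rwa [one_mul, add_comm] at this
  have hsumI : ∀ e : ι₂ → K, ∑ j, e j • f j ∈ I := fun e =>
    (I.restrictScalars K).sum_mem fun j _ => (I.restrictScalars K).smul_mem _ (hf j).1
  have hmulsum : ∀ c : ι₁ → K, l ^ k * ∑ j, c j • u j = ∑ j, c j • (l ^ k * u j) := fun c => by
    rw [Finset.mul_sum]
    exact Finset.sum_congr rfl fun j _ => mul_smul_comm _ _ _
  have husum : ∀ c : ι₁ → K, (∑ j, c j • u j).IsHomogeneous i := fun c =>
    (homogeneousSubmodule (Fin n) K i).sum_mem fun j _ =>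
      (homogeneousSubmodule (Fin n) K i).smul_mem _ (h.isHomogeneous j)
  have hsum : ∀ c : ι₁ ⊕ ι₂ → K, ∑ j, c j • mulFamily l k u f j =
      l ^ k * (∑ j, c (Sum.inl j) • u j) + ∑ j, c (Sum.inr j) • f j := fun c => by
    rw [Fintype.sum_sum_type, hmulsum]
    rfl
  refine or_congr ?_ ?_
  · rw [Fintype.linearIndependent_iff]
    constructor
    · intro hinj c hc
      rw [hsum] at hc
      have h1 : ∑ j, c (Sum.inl j) • u j ∈ I := by
        refine hinj _ (husum _) ?_
        rw [eq_neg_of_add_eq_zero_left hc]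
        exact I.neg_mem (hsumI _)
      have h2 := h.eq_zero_of_sum_mem _ h1
      have h3 : ∑ j, c (Sum.inl j) • u j = 0 :=
        Finset.sum_eq_zero fun j _ => by rw [congrFun h2 j]; simp
      rw [h3, mul_zero, zero_add] at hc
      have h4 := Fintype.linearIndependent_iff.1 h.linearIndependent _ hc
      rintro (j | j)
      exacts [congrFun h2 j, h4 j]
    · intro hli q hq hlq
      obtain ⟨c, hc⟩ := h.exists_sub_mem q hq
      have h1 : l ^ k * ∑ j, c j • u j ∈ I := by
        have := I.sub_mem hlq (I.mul_mem_left (l ^ k) hc)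
        rwa [mul_sub, sub_sub_cancel] at this
      obtain ⟨e, he⟩ := h.exists_eq h1 (hom _ (husum c))
      have h2 := hli (Sum.elim c (-e)) (by rw [hsum]; simp [he])
      have h3 : ∑ j, c j • u j = 0 :=
        Finset.sum_eq_zero fun j _ => by
          have : c j = 0 := h2 (Sum.inl j)
          rw [this, zero_smul]
      rwa [h3, sub_zero] at hc
  · have hle : Submodule.span K (Set.range (mulFamily l k u f)) ≤
        homogeneousSubmodule (Fin n) K (i + k) := by
      rw [Submodule.span_le]
      rintro _ ⟨j, rfl⟩
      exact mulFamily_isHomogeneous hl h.isHomogeneous (fun j => (hf j).2) j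
    constructor
    · refine fun hsurj => le_antisymm hle fun q hq => ?_
      obtain ⟨r, hr, hqr⟩ := hsurj q hq
      obtain ⟨c, hc⟩ := h.exists_sub_mem r hr
      have h1 : q - l ^ k * ∑ j, c j • u j ∈ I := by
        have := I.add_mem hqr (I.mul_mem_left (l ^ k) hc)
        rwa [mul_sub, sub_add_sub_cancel] at this
      obtain ⟨e, he⟩ := h.exists_eq h1 (IsHomogeneous.sub hq (hom _ (husum c)))
      refine (Submodule.mem_span_range_iff_exists_fun K).2 ⟨Sum.elim c e, ?_⟩
      rw [hsum]
      simp [he]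
    · intro hspan q hq
      have hq' : q ∈ Submodule.span K (Set.range (mulFamily l k u f)) := hspan ▸ hq
      obtain ⟨c, hc⟩ := (Submodule.mem_span_range_iff_exists_fun K).1 hq'
      refine ⟨∑ j, c (Sum.inl j) • u j, husum _, ?_⟩
      rw [← hc, hsum, add_sub_cancel_left]
      exact hsumI _

/-- If a family over a `K`-algebra `R` specializes at the `K`-point `φ₀` to one that is independent
or spans all forms of its degree, then so it does on a basic open neighbourhood of `φ₀`. -/
theorem exists_forall_linearIndependent_or_span_eq {R ι : Type*} [CommRing R] [Algebra K R]
    [Finite ι] {F : ι → MvPolynomial (Fin n) R} (hF : ∀ j, (F j).IsHomogeneous d)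
    (φ₀ : R →ₐ[K] K)
    (h : LinearIndependent K (fun j => map (φ₀ : R →+* K) (F j)) ∨
      Submodule.span K (Set.range fun j => map (φ₀ : R →+* K) (F j)) =
        homogeneousSubmodule (Fin n) K d) :
    ∃ p : R, φ₀ p ≠ 0 ∧ ∀ φ : R →ₐ[K] K, φ p ≠ 0 →
      LinearIndependent K (fun j => map (φ : R →+* K) (F j)) ∨
        Submodule.span K (Set.range fun j => map (φ : R →+* K) (F j)) =
          homogeneousSubmodule (Fin n) K d := by
  rcases h with h | h
  · obtain ⟨p, hp, hp'⟩ := exists_forall_linearIndependent hF φ₀ h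
    exact ⟨p, hp, fun φ hφ => Or.inl (hp' φ hφ)⟩
  · obtain ⟨p, hp, hp'⟩ := exists_forall_span_eq hF φ₀ h
    exact ⟨p, hp, fun φ hφ => Or.inr (hp' φ hφ)⟩

/-- Maximal rank is an open condition on the linear form. -/
theorem IsAdapted.exists_forall_maxRankOnForms {R : Type*} [CommRing R] [Algebra K R]
    {u : ι₁ → MvPolynomial (Fin n) K} {f : ι₂ → MvPolynomial (Fin n) K}
    (h : IsAdapted I i (i + k) u f) {l : MvPolynomial (Fin n) R} (hl : l.IsHomogeneous 1)
    (φ₀ : R →ₐ[K] K) (h₀ : MaxRankOnForms I (map (φ₀ : R →+* K) l) k i) :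
    ∃ p : R, φ₀ p ≠ 0 ∧ ∀ φ : R →ₐ[K] K, φ p ≠ 0 →
      MaxRankOnForms I (map (φ : R →+* K) l) k i := by
  have key : ∀ φ : R →ₐ[K] K, (fun j => map (φ : R →+* K) (mulFamily l k
      (fun j => map (algebraMap K R) (u j)) (fun j => map (algebraMap K R) (f j)) j)) =
      mulFamily (map (φ : R →+* K) l) k u f := by
    intro φ
    have hφ : (φ : R →+* K).comp (algebraMap K R) = RingHom.id K := by
      ext x
      simp
    rw [map_mulFamily]
    simp only [map_map, hφ, map_id]
  have hF := mulFamily_isHomogeneous (k := k) hl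
    (fun j => (h.isHomogeneous j).map (algebraMap K R))
    (fun j => (h.mem j).2.map (algebraMap K R))
  obtain ⟨p, hp, hp'⟩ := exists_forall_linearIndependent_or_span_eq hF φ₀ (by
    rw [key]
    exact (h.maxRankOnForms_iff (hl.map _)).1 h₀)
  refine ⟨p, hp, fun φ hφ => (h.maxRankOnForms_iff (hl.map _)).2 ?_⟩
  have := hp' φ hφ
  rwa [key] at this

end Adapted

/-! ### Initial ideals and standard monomials -/

section Initial

variable {K : Type*} [Field K] {n : ℕ} {m : MonomialOrder (Fin n)}
  {I : Ideal (MvPolynomial (Fin n) K)}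

/-- The exponents of the leading monomials of the nonzero elements of `I`. -/
def leadExps (m : MonomialOrder (Fin n)) (I : Ideal (MvPolynomial (Fin n) K)) :
    Set (Fin n →₀ ℕ) :=
  {a | ∃ f ∈ I, f ≠ 0 ∧ m.degree f = a}

theorem leadExps_add {a : Fin n →₀ ℕ} (ha : a ∈ leadExps m I) (b : Fin n →₀ ℕ) :
    b + a ∈ leadExps m I := by
  classical
  obtain ⟨f, hf, hf0, rfl⟩ := ha
  have hb : (monomial b (1 : K)) ≠ 0 := by simp
  refine ⟨monomial b 1 * f, I.mul_mem_left _ hf, mul_ne_zero hb hf0, ?_⟩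
  rw [m.degree_mul hb hf0, m.degree_monomial, if_neg one_ne_zero]

theorem mem_initialIdeal_iff {f : MvPolynomial (Fin n) K} :
    f ∈ initialIdeal m I ↔ ∀ a ∈ f.support, a ∈ leadExps m I := by
  have h : initialIdeal m I = Ideal.span ((fun a => monomial a (1 : K)) '' leadExps m I) := by
    rw [initialIdeal, m.span_leadingTerm_eq_span_monomial']
    congr 1
    ext q
    constructor
    · rintro ⟨f, ⟨hf, hf0⟩, rfl⟩
      exact ⟨_, ⟨f, hf, hf0, rfl⟩, rfl⟩
    · rintro ⟨_, ⟨f, hf, hf0, rfl⟩, rfl⟩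
      exact ⟨f, ⟨hf, hf0⟩, rfl⟩
  rw [h, mem_ideal_span_monomial_image]
  refine forall₂_congr fun a _ => ⟨?_, fun ha => ⟨a, ha, le_rfl⟩⟩
  rintro ⟨b, hb, hba⟩
  obtain ⟨c, rfl⟩ := exists_add_of_le hba
  rw [add_comm]
  exact leadExps_add hb c

theorem degree_eq_of_forall_le {f : MvPolynomial (Fin n) K} {a : Fin n →₀ ℕ}
    (ha : coeff a f ≠ 0) (h : ∀ b ∈ f.support, m.toSyn b ≤ m.toSyn a) : m.degree f = a :=
  m.toSyn.injective (le_antisymm (m.degree_le_iff.2 h) (m.le_degree (mem_support_iff.2 ha)))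

theorem mem_leadExps_of_forall_le {f : MvPolynomial (Fin n) K} (hf : f ∈ I) {a : Fin n →₀ ℕ}
    (ha : coeff a f ≠ 0) (h : ∀ b ∈ f.support, m.toSyn b ≤ m.toSyn a) : a ∈ leadExps m I :=
  ⟨f, hf, fun h0 => ha (by rw [h0, coeff_zero]), degree_eq_of_forall_le ha h⟩

/-- `f` is a form with leading monomial `x ^ a` and leading coefficient `1`. -/
structure IsMonicForm (m : MonomialOrder (Fin n)) (a : Fin n →₀ ℕ)
    (f : MvPolynomial (Fin n) K) : Prop where
  isHomogeneous : f.IsHomogeneous a.degree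
  coeff_eq : coeff a f = 1
  le : ∀ b ∈ f.support, m.toSyn b ≤ m.toSyn a

theorem IsMonicForm.degree_eq {a : Fin n →₀ ℕ} {f : MvPolynomial (Fin n) K}
    (h : IsMonicForm m a f) : m.degree f = a :=
  degree_eq_of_forall_le (by rw [h.coeff_eq]; exact one_ne_zero) h.le

theorem IsMonicForm.ne_zero {a : Fin n →₀ ℕ} {f : MvPolynomial (Fin n) K}
    (h : IsMonicForm m a f) : f ≠ 0 := by
  rintro rfl
  simpa using h.coeff_eq

theorem isMonicForm_monomial (m : MonomialOrder (Fin n)) (a : Fin n →₀ ℕ) :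
    IsMonicForm m a (monomial a (1 : K)) := by
  classical
  refine ⟨isHomogeneous_monomial _ rfl, by simp, fun b hb => ?_⟩
  rw [Finset.mem_singleton.1 (support_monomial_subset hb)]

theorem exists_isMonicForm (hI : I.IsHomogeneous (homogeneousSubmodule (Fin n) K))
    {a : Fin n →₀ ℕ} (ha : a ∈ leadExps m I) : ∃ f ∈ I, IsMonicForm m a f := by
  obtain ⟨f, hf, hf0, rfl⟩ := ha
  have hc : m.leadingCoeff f ≠ 0 := m.leadingCoeff_ne_zero_iff.2 hf0
  refine ⟨C (m.leadingCoeff f)⁻¹ * homogeneousComponent (m.degree f).degree f,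
    I.mul_mem_left _ (homogeneousComponent_mem_of_mem hI hf _),
    (homogeneousComponent_isHomogeneous _ _).C_mul _, ?_, fun b hb => ?_⟩
  · rw [coeff_C_mul, coeff_homogeneousComponent, if_pos rfl]
    exact inv_mul_cancel₀ hc
  · rw [mem_support_iff, coeff_C_mul, coeff_homogeneousComponent] at hb
    refine m.le_degree (mem_support_iff.2 fun h0 => hb ?_)
    rw [h0, ite_self, mul_zero]

/-- Two nested spaces of polynomials with the same leading monomials are equal. -/
theorem le_of_forall_exists_degree_eq {V W : Submodule K (MvPolynomial (Fin n) K)} (hWV : W ≤ V)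
    (h : ∀ v ∈ V, v ≠ 0 → ∃ w ∈ W, w ≠ 0 ∧ m.degree w = m.degree v) : V ≤ W := by
  suffices H : ∀ s : m.syn, ∀ v ∈ V, m.toSyn (m.degree v) = s → v ∈ W from
    fun v hv => H _ v hv rfl
  intro s
  induction s using WellFoundedLT.induction with
  | ind s ih =>
    rintro v hv rfl
    by_cases hv0 : v = 0
    · rw [hv0]
      exact W.zero_mem
    obtain ⟨w, hw, hw0, hdeg⟩ := h v hv hv0
    have hwc : m.leadingCoeff w ≠ 0 := m.leadingCoeff_ne_zero_iff.2 hw0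
    set c := m.leadingCoeff v / m.leadingCoeff w
    have hcw : c • w ∈ W := W.smul_mem _ hw
    suffices hmem : v - c • w ∈ W by simpa using W.add_mem hmem hcw
    by_cases h0 : v - c • w = 0
    · rw [h0]
      exact W.zero_mem
    refine ih _ (lt_of_le_of_ne ?_ fun heq => ?_) _ (V.sub_mem hv (hWV hcw)) rfl
    · refine m.degree_sub_le.trans (sup_le le_rfl ?_)
      rw [← hdeg]
      exact m.degree_smul_le
    · refine h0 (m.coeff_degree_eq_zero_iff.1 ?_)
      rw [m.toSyn.injective heq, coeff_sub, coeff_smul, ← hdeg, smul_eq_mul,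
        show coeff (m.degree w) w = m.leadingCoeff w from rfl, div_mul_cancel₀ _ hwc, hdeg]
      exact sub_self _

instance (d : ℕ) (P : (Fin n →₀ ℕ) → Prop) : Finite {a : Fin n →₀ ℕ // a.degree = d ∧ P a} :=
  Finite.of_injective
    (fun a => (⟨a.1, a.2.1⟩ : {a : Fin n →₀ ℕ // a.degree = d}))
    fun _ _ h => Subtype.ext (congrArg (fun x => x.1) h)

noncomputable instance (d : ℕ) (P : (Fin n →₀ ℕ) → Prop) :
    Fintype {a : Fin n →₀ ℕ // a.degree = d ∧ P a} :=
  Fintype.ofFinite _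

/-- Macaulay's basis theorem, with the accompanying triangular basis of `I_d`. -/
theorem isAdapted_of_isMonicForm {E : Set (Fin n →₀ ℕ)} (hE : leadExps m I = E) (i d : ℕ)
    {f : (Fin n →₀ ℕ) → MvPolynomial (Fin n) K} (hfI : ∀ a ∈ E, f a ∈ I)
    (hf : ∀ a ∈ E, IsMonicForm m a (f a)) :
    IsAdapted I i d (fun a : {a : Fin n →₀ ℕ // a.degree = i ∧ a ∉ E} => monomial a.1 (1 : K))
      (fun a : {a : Fin n →₀ ℕ // a.degree = d ∧ a ∈ E} => f a.1) := by
  classical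
  have hdeg : ∀ e, ∀ v : MvPolynomial (Fin n) K, v.IsHomogeneous e → v ≠ 0 →
      (m.degree v).degree = e := fun e v hv hv0 => by
    by_contra hne
    exact m.coeff_degree_ne_zero_iff.2 hv0 (hv.coeff_eq_zero hne)
  refine ⟨fun a => isHomogeneous_monomial _ a.2.1, fun q hq => ?_, fun c hc => ?_, ?_, ?_⟩
  · have hle : homogeneousSubmodule (Fin n) K i ≤
        (I.restrictScalars K ⊓ homogeneousSubmodule (Fin n) K i) ⊔
          Submodule.span K (Set.range fun a : {a : Fin n →₀ ℕ // a.degree = i ∧ a ∉ E} =>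
            monomial a.1 (1 : K)) := by
      refine le_of_forall_exists_degree_eq (m := m) (sup_le inf_le_right ?_) fun v hv hv0 => ?_
      · rw [Submodule.span_le]
        rintro _ ⟨a, rfl⟩
        exact isHomogeneous_monomial _ a.2.1
      · by_cases ha : m.degree v ∈ E
        · refine ⟨f (m.degree v), Submodule.mem_sup_left ⟨hfI _ ha, ?_⟩, (hf _ ha).ne_zero,
            (hf _ ha).degree_eq⟩
          have := (hf _ ha).isHomogeneous
          rwa [hdeg i v hv hv0] at this
        · exact ⟨monomial (m.degree v) 1, Submodule.mem_sup_right
            (Submodule.subset_span ⟨⟨m.degree v, hdeg i v hv hv0, ha⟩, rfl⟩),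
            (isMonicForm_monomial m _).ne_zero, (isMonicForm_monomial m _).degree_eq⟩
    obtain ⟨x, hx, y, hy, rfl⟩ := Submodule.mem_sup.1 (hle hq)
    obtain ⟨c, rfl⟩ := (Submodule.mem_span_range_iff_exists_fun K).1 hy
    exact ⟨c, by simpa using hx.1⟩
  · have hcoeff : ∀ b : Fin n →₀ ℕ,
        coeff b (∑ a : {a : Fin n →₀ ℕ // a.degree = i ∧ a ∉ E}, c a • monomial a.1 (1 : K)) =
          if h : b.degree = i ∧ b ∉ E then c ⟨b, h⟩ else 0 := by
      intro b
      simp only [coeff_sum, coeff_smul, coeff_monomial, smul_eq_mul, mul_ite, mul_one, mul_zero]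
      split_ifs with h
      · rw [Finset.sum_eq_single ⟨b, h⟩] <;> simp +contextual [Subtype.ext_iff]
      · refine Finset.sum_eq_zero fun a _ => if_neg ?_
        rintro rfl
        exact h a.2
    by_contra hne
    obtain ⟨a, ha⟩ := Function.ne_iff.1 hne
    set q := ∑ a : {a : Fin n →₀ ℕ // a.degree = i ∧ a ∉ E}, c a • monomial a.1 (1 : K)
    have hq0 : q ≠ 0 := fun h0 => ha (by
      have := hcoeff a.1
      rwa [h0, coeff_zero, dif_pos a.2, eq_comm] at this)
    have hmem : m.degree q ∈ E := hE ▸ ⟨q, hc, hq0, rfl⟩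
    have := m.coeff_degree_ne_zero_iff.2 hq0
    rw [hcoeff, dif_neg fun h => h.2 hmem] at this
    exact this rfl
  · rw [Fintype.linearIndependent_iff]
    intro c hc
    by_contra! hne
    -- look at the coefficient of the largest leading monomial that occurs in the relation
    obtain ⟨a, ha, hmax⟩ := Finset.exists_max_image (Finset.univ.filter fun a => c a ≠ 0)
      (fun a => m.toSyn a.1) (hne.imp fun a ha => by simpa using ha)
    have h1 : coeff a.1 (∑ b, c b • f b.1) = c a := by
      rw [coeff_sum, Finset.sum_eq_single a]
      · rw [coeff_smul, (hf _ a.2.2).coeff_eq, smul_eq_mul, mul_one]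
      · intro b _ hba
        rw [coeff_smul, smul_eq_mul]
        by_contra h0
        refine hba (Subtype.ext (m.toSyn.injective (le_antisymm ?_ ?_)))
        · exact hmax b (by simpa using left_ne_zero_of_mul h0)
        · exact (hf _ b.2.2).le _ (mem_support_iff.2 (right_ne_zero_of_mul h0))
      · simp
    rw [hc, coeff_zero] at h1
    exact (Finset.mem_filter.1 ha).2 h1.symm
  · have hle : Submodule.span K (Set.range
        fun a : {a : Fin n →₀ ℕ // a.degree = d ∧ a ∈ E} => f a.1) ≤
        I.restrictScalars K ⊓ homogeneousSubmodule (Fin n) K d := by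
      rw [Submodule.span_le]
      rintro _ ⟨a, rfl⟩
      refine ⟨hfI _ a.2.2, ?_⟩
      have := (hf _ a.2.2).isHomogeneous
      rwa [a.2.1] at this
    refine le_antisymm hle (le_of_forall_exists_degree_eq (m := m) hle fun v hv hv0 => ?_)
    have ha : m.degree v ∈ E := hE ▸ ⟨v, hv.1, hv0, rfl⟩
    exact ⟨f (m.degree v), Submodule.subset_span ⟨⟨m.degree v, hdeg d v hv.2 hv0, ha⟩, rfl⟩,
      (hf _ ha).ne_zero, (hf _ ha).degree_eq⟩

theorem leadExps_initialIdeal (m : MonomialOrder (Fin n)) (I : Ideal (MvPolynomial (Fin n) K)) :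
    leadExps m (initialIdeal m I) = leadExps m I := by
  ext a
  constructor
  · rintro ⟨f, hf, hf0, rfl⟩
    exact mem_initialIdeal_iff.1 hf _ (m.degree_mem_support hf0)
  · intro ha
    refine ⟨monomial a 1, mem_initialIdeal_iff.2 fun b hb => ?_,
      (isMonicForm_monomial m a).ne_zero, (isMonicForm_monomial m a).degree_eq⟩
    rwa [Finset.mem_singleton.1 (support_monomial_subset hb)]

/-- The standard monomials of degree `i` and the monomials of degree `d` in the initial ideal are
adapted to the initial ideal. -/
theorem isAdapted_initialIdeal (m : MonomialOrder (Fin n)) (I : Ideal (MvPolynomial (Fin n) K))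
    (i d : ℕ) :
    IsAdapted (initialIdeal m I) i d
      (fun a : {a : Fin n →₀ ℕ // a.degree = i ∧ a ∉ leadExps m I} => monomial a.1 (1 : K))
      (fun a : {a : Fin n →₀ ℕ // a.degree = d ∧ a ∈ leadExps m I} => monomial a.1 (1 : K)) :=
  isAdapted_of_isMonicForm (leadExps_initialIdeal m I) i d (f := fun a => monomial a 1)
    (fun a ha => mem_initialIdeal_iff.2 fun b hb => by
      rwa [Finset.mem_singleton.1 (support_monomial_subset hb)])
    fun a _ => isMonicForm_monomial m a

end Initial

/-! ### Degeneration to the initial ideal -/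

section Degeneration

variable {K : Type*} [Field K] {n : ℕ} {I : Ideal (MvPolynomial (Fin n) K)}

/-- The weight of `x ^ a` when the `j`-th variable (counted from `0`) has weight `N ^ j`. -/
def expWeight (N : ℕ) (a : Fin n →₀ ℕ) : ℕ := ∑ j, a j * N ^ (j : ℕ)

/-- In degrees below `N`, the weights `N ^ j` refine the reverse lexicographic order, reversed. -/
theorem expWeight_lt_of_revLex_lt {N : ℕ} {a b : Fin n →₀ ℕ} (hab : a.degree = b.degree)
    (hN : a.degree < N) (h : (revLex n).toSyn b < (revLex n).toSyn a) :
    expWeight N a < expWeight N b := by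
  obtain ⟨i, hi, hlt⟩ := ((revLex_lt_iff.1 h).resolve_left hab.not_gt).2
  have hlow : ∑ j, (if j < i then a j * N ^ (j : ℕ) else 0) < N ^ (i : ℕ) := by
    have hNpos : 0 < N := by lia
    refine lt_of_mul_lt_mul_right ?_ (Nat.zero_le N)
    rw [Finset.sum_mul]
    calc ∑ j, (if j < i then a j * N ^ (j : ℕ) else 0) * N
        ≤ ∑ j, a j * N ^ (i : ℕ) := by
          refine Finset.sum_le_sum fun j _ => ?_
          split_ifs with hj
          · rw [mul_assoc, ← pow_succ]
            exact Nat.mul_le_mul_left _ (Nat.pow_le_pow_right hNpos hj)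
          · simp
      _ = a.degree * N ^ (i : ℕ) := by rw [← Finset.sum_mul, Finsupp.degree_eq_sum]
      _ < N * N ^ (i : ℕ) := Nat.mul_lt_mul_of_pos_right hN (pow_pos hNpos _)
      _ = N ^ (i : ℕ) * N := mul_comm _ _
  have hle : ∑ j, (a j * N ^ (j : ℕ) + if j = i then N ^ (i : ℕ) else 0) ≤
      ∑ j, (b j * N ^ (j : ℕ) + if j < i then a j * N ^ (j : ℕ) else 0) := by
    refine Finset.sum_le_sum fun j _ => ?_
    rcases lt_trichotomy j i with hj | rfl | hj
    · simp [hj, hj.ne]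
    · have := Nat.mul_le_mul_right (N ^ (j : ℕ)) (Nat.succ_le_of_lt hlt)
      simp only [if_true, lt_irrefl, if_false, add_zero]
      calc _ = (a j + 1) * N ^ (j : ℕ) := by ring
        _ ≤ _ := this
    · simp [hj.ne', hj.not_gt, hi j hj]
  rw [Finset.sum_add_distrib, Finset.sum_add_distrib, Finset.sum_ite_eq' Finset.univ i,
    if_pos (Finset.mem_univ i)] at hle
  unfold expWeight
  lia

/-- The diagonal matrix with entries `v j`, as an element of `GL_n(K)`. -/
def diagGL (v : Fin n → Kˣ) : GL (Fin n) K where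
  val := Matrix.diagonal fun j => (v j : K)
  inv := Matrix.diagonal fun j => ((v j)⁻¹ : Kˣ)
  val_inv := by simp [Matrix.diagonal_mul_diagonal]
  inv_val := by simp [Matrix.diagonal_mul_diagonal]

theorem coeff_glAct_diagGL (v : Fin n → Kˣ) (f : MvPolynomial (Fin n) K) (a : Fin n →₀ ℕ) :
    coeff a (glAct (diagGL v) f) = (∏ j, (v j : K) ^ a j) * coeff a f := by
  classical
  have hX : ∀ j, ∑ i, C ((diagGL v).val i j) * X i = (C (v j : K) * X j : MvPolynomial (Fin n) K) :=
    fun j => by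
      rw [Finset.sum_eq_single j]
      · simp [diagGL]
      · intro i _ hij
        simp [diagGL, Matrix.diagonal_apply_ne _ hij]
      · simp
  induction f using MvPolynomial.induction_on' with
  | monomial b c =>
    have : glAct (diagGL v) (monomial b c) = monomial b ((∏ j, (v j : K) ^ b j) * c) := by
      rw [glAct, aeval_monomial, Finsupp.prod_fintype _ _ fun j => pow_zero _]
      simp only [hX, mul_pow]
      rw [Finset.prod_mul_distrib, algebraMap_eq, monomial_eq, Finsupp.prod_fintype _ _
        fun j => pow_zero _, C_mul, map_prod]
      simp only [C_pow]
      ring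
    rw [this, coeff_monomial, coeff_monomial]
    split_ifs with h
    · rw [h]
    · rw [mul_zero]
  | add p q hp hq => rw [map_add, coeff_add, coeff_add, hp, hq, mul_add]

theorem coeff_glAct_diagGL_pow (N : ℕ) (t : Kˣ) (f : MvPolynomial (Fin n) K) (a : Fin n →₀ ℕ) :
    coeff a (glAct (diagGL fun j : Fin n => t ^ N ^ (j : ℕ)) f) =
      (t : K) ^ expWeight N a * coeff a f := by
  rw [coeff_glAct_diagGL, expWeight, ← Finset.prod_pow_eq_pow_sum]
  congr 1
  refine Finset.prod_congr rfl fun j _ => ?_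
  rw [Units.val_pow_eq_pow_val, ← pow_mul, mul_comm]

theorem IsAdapted.smul_glAct {ι₁ ι₂ : Type*} [Fintype ι₁] [Fintype ι₂] {i d : ℕ}
    {u : ι₁ → MvPolynomial (Fin n) K} {f : ι₂ → MvPolynomial (Fin n) K}
    (h : IsAdapted I i d u f) (g : GL (Fin n) K) (c : ι₁ → Kˣ) (e : ι₂ → Kˣ) :
    IsAdapted (glIdeal g I) i d (fun j => (c j : K) • glAct g (u j))
      (fun j => (e j : K) • glAct g (f j)) := by
  refine ⟨fun j => ?_, fun q hq => ?_, fun b hb => ?_, ?_, ?_⟩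
  · exact (homogeneousSubmodule (Fin n) K i).smul_mem _ (glAct_isHomogeneous g (h.isHomogeneous j))
  · obtain ⟨b, hb⟩ := h.exists_sub_mem _ (glAct_isHomogeneous g⁻¹ hq)
    refine ⟨fun j => b j * ((c j)⁻¹ : Kˣ), ?_⟩
    rw [mem_glIdeal_iff]
    simpa [map_sub, map_sum, smul_smul, glAct_inv_apply] using hb
  · rw [mem_glIdeal_iff] at hb
    have h0 := h.eq_zero_of_sum_mem (fun j => b j * (c j : K)) (by
      simpa [map_sum, smul_smul, glAct_inv_apply] using hb)
    funext j
    exact (mul_eq_zero.1 (congrFun h0 j)).resolve_right (c j).ne_zero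
  · have hinj : Function.Injective (glAct g) :=
      Function.LeftInverse.injective (glAct_inv_apply g)
    have := (h.linearIndependent.map' (glAct g).toLinearMap (LinearMap.ker_eq_bot.2 hinj))
    exact this.units_smul e
  · refine le_antisymm ?_ fun q hq => ?_
    · rw [Submodule.span_le]
      rintro _ ⟨j, rfl⟩
      refine Submodule.smul_mem _ _ ⟨?_, glAct_isHomogeneous g (h.mem j).2⟩
      exact Ideal.mem_map_of_mem (glAct g) (h.mem j).1
    · obtain ⟨b, hb⟩ := h.exists_eq (mem_glIdeal_iff.1 hq.1) (glAct_isHomogeneous g⁻¹ hq.2)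
      refine (Submodule.mem_span_range_iff_exists_fun K).2 ⟨fun j => b j * ((e j)⁻¹ : Kˣ), ?_⟩
      rw [← glAct_apply_inv g q, ← hb]
      simp [map_sum, smul_smul]

/-- The form `f`, homogenized along the weights `N ^ j` and divided by the power of the parameter
that belongs to `x ^ a`. -/
noncomputable def weightDeform (N : ℕ) (a : Fin n →₀ ℕ) (f : MvPolynomial (Fin n) K) :
    MvPolynomial (Fin n) (Polynomial K) :=
  ∑ b ∈ f.support, monomial b
    (Polynomial.C (coeff b f) * Polynomial.X ^ (expWeight N b - expWeight N a))

theorem coeff_map_weightDeform (N : ℕ) (a : Fin n →₀ ℕ) (f : MvPolynomial (Fin n) K) (t : K)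
    (b : Fin n →₀ ℕ) :
    coeff b (map (Polynomial.aeval t : Polynomial K →ₐ[K] K) (weightDeform N a f)) =
      coeff b f * t ^ (expWeight N b - expWeight N a) := by
  classical
  rw [coeff_map, weightDeform, coeff_sum]
  simp only [coeff_monomial]
  rw [Finset.sum_ite_eq']
  split_ifs with h
  · simp
  · rw [notMem_support_iff.1 h]
    simp

theorem weightDeform_isHomogeneous (N : ℕ) (a : Fin n →₀ ℕ) {f : MvPolynomial (Fin n) K} {d : ℕ}
    (hf : f.IsHomogeneous d) : (weightDeform N a f).IsHomogeneous d :=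
  IsHomogeneous.sum _ _ _ fun _ hb =>
    isHomogeneous_monomial _ (by
      by_contra h
      exact mem_support_iff.1 hb (hf.coeff_eq_zero h))

theorem expWeight_lt_of_isMonicForm {N : ℕ} {a b : Fin n →₀ ℕ} {f : MvPolynomial (Fin n) K}
    (hf : IsMonicForm (revLex n) a f) (hN : a.degree < N) (hb : b ∈ f.support) (hba : b ≠ a) :
    expWeight N a < expWeight N b := by
  refine expWeight_lt_of_revLex_lt ?_ hN
    (lt_of_le_of_ne (hf.le b hb) fun h => hba ((revLex n).toSyn.injective h))
  by_contra h
  exact mem_support_iff.1 hb (hf.isHomogeneous.coeff_eq_zero (Ne.symm h))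

theorem map_weightDeform_zero {N : ℕ} {a : Fin n →₀ ℕ} {f : MvPolynomial (Fin n) K}
    (hf : IsMonicForm (revLex n) a f) (hN : a.degree < N) :
    map (Polynomial.aeval (0 : K) : Polynomial K →ₐ[K] K) (weightDeform N a f) =
      monomial a (1 : K) := by
  classical
  ext b
  rw [coeff_map_weightDeform, coeff_monomial]
  split_ifs with h
  · rw [← h, hf.coeff_eq]
    simp
  · by_cases hb : b ∈ f.support
    · have := expWeight_lt_of_isMonicForm hf hN hb (Ne.symm h)
      rw [zero_pow (by lia), mul_zero]
    · rw [notMem_support_iff.1 hb, zero_mul]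

theorem map_weightDeform_unit {N : ℕ} {a : Fin n →₀ ℕ} {f : MvPolynomial (Fin n) K}
    (hf : IsMonicForm (revLex n) a f) (hN : a.degree < N) (t : Kˣ) :
    map (Polynomial.aeval (t : K) : Polynomial K →ₐ[K] K) (weightDeform N a f) =
      (((t ^ expWeight N a)⁻¹ : Kˣ) : K) •
        glAct (diagGL fun j : Fin n => t ^ N ^ (j : ℕ)) f := by
  ext b
  rw [coeff_map_weightDeform, coeff_smul, coeff_glAct_diagGL_pow]
  by_cases hb : b ∈ f.support
  · have hle : expWeight N a ≤ expWeight N b := by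
      by_cases hba : b = a
      · rw [hba]
      · exact (expWeight_lt_of_isMonicForm hf hN hb hba).le
    obtain ⟨c, hc⟩ := exists_add_of_le hle
    rw [hc, add_tsub_cancel_left, pow_add, smul_eq_mul, ← mul_assoc, ← mul_assoc,
      Units.val_inv_eq_inv_val, Units.val_pow_eq_pow_val,
      inv_mul_cancel₀ (pow_ne_zero _ t.ne_zero), one_mul, mul_comm]
  · rw [notMem_support_iff.1 hb]
    simp

/-- If `l ^ k` has maximal rank on the quotient by the initial ideal, then the quotient by `I`
has a linear form with the same property: the ideals `t • I`, for the one-parameter group with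
weights `N ^ j`, degenerate to the initial ideal, and maximal rank is an open condition. -/
theorem exists_maxRankOnForms_of_initialIdeal [Infinite K]
    (hI : I.IsHomogeneous (homogeneousSubmodule (Fin n) K)) {l : MvPolynomial (Fin n) K}
    (hl : l.IsHomogeneous 1) {k i : ℕ}
    (h : MaxRankOnForms (initialIdeal (revLex n) I) l k i) :
    ∃ l' : MvPolynomial (Fin n) K, l'.IsHomogeneous 1 ∧ MaxRankOnForms I l' k i := by
  classical
  choose! f hfI hf using fun a (ha : a ∈ leadExps (revLex n) I) => exists_isMonicForm hI ha
  set N := i + k + 1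
  have hN : ∀ a : {a : Fin n →₀ ℕ // a.degree = i + k ∧ a ∈ leadExps (revLex n) I},
      a.1.degree < N := fun a => by
    have := a.2.1
    lia
  have hadapt := isAdapted_of_isMonicForm rfl i (i + k) hfI hf
  -- the family over `K[t]` interpolating between the initial ideal and the ideals `t • I`
  set F := mulFamily (map (algebraMap K (Polynomial K)) l) k
    (fun a : {a : Fin n →₀ ℕ // a.degree = i ∧ a ∉ leadExps (revLex n) I} =>
      (monomial a.1 1 : MvPolynomial (Fin n) (Polynomial K)))
    (fun a : {a : Fin n →₀ ℕ // a.degree = i + k ∧ a ∈ leadExps (revLex n) I} =>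
      weightDeform N a.1 (f a.1)) with hFdef
  have hF : ∀ j, (F j).IsHomogeneous (i + k) :=
    mulFamily_isHomogeneous (hl.map _) (fun a => isHomogeneous_monomial _ a.2.1) fun a => by
      have := (hf _ a.2.2).isHomogeneous
      rw [a.2.1] at this
      exact weightDeform_isHomogeneous _ _ this
  have hFmap : ∀ t : K,
      (fun j => map ((Polynomial.aeval t : Polynomial K →ₐ[K] K) : Polynomial K →+* K) (F j)) =
      mulFamily l k
        (fun a : {a : Fin n →₀ ℕ // a.degree = i ∧ a ∉ leadExps (revLex n) I} =>
          (monomial a.1 1 : MvPolynomial (Fin n) K))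
        (fun a : {a : Fin n →₀ ℕ // a.degree = i + k ∧ a ∈ leadExps (revLex n) I} =>
          map ((Polynomial.aeval t : Polynomial K →ₐ[K] K) : Polynomial K →+* K)
            (weightDeform N a.1 (f a.1))) := by
    intro t
    have ht : ((Polynomial.aeval t : Polynomial K →ₐ[K] K) : Polynomial K →+* K).comp
        (algebraMap K (Polynomial K)) = RingHom.id K := by
      ext x
      simp
    rw [hFdef, map_mulFamily]
    simp only [map_map, ht, map_id, map_monomial, map_one]
  obtain ⟨p, hp0, hp⟩ := exists_forall_linearIndependent_or_span_eq hF
    (Polynomial.aeval (0 : K)) (by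
      rw [hFmap]
      simp only [fun a : {a : Fin n →₀ ℕ // a.degree = i + k ∧ a ∈ leadExps (revLex n) I} =>
        map_weightDeform_zero (hf _ a.2.2) (hN a)]
      exact ((isAdapted_initialIdeal (revLex n) I i (i + k)).maxRankOnForms_iff hl).1 h)
  have hpne : Polynomial.X * p ≠ 0 := by
    refine mul_ne_zero Polynomial.X_ne_zero ?_
    rintro rfl
    exact hp0 (map_zero _)
  obtain ⟨t₀, ht₀⟩ : ∃ t : K, (Polynomial.X * p).eval t ≠ 0 := by
    by_contra! hall
    exact hpne (Polynomial.funext fun t => by rw [hall, Polynomial.eval_zero])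
  rw [Polynomial.eval_mul, Polynomial.eval_X] at ht₀
  set t : Kˣ := Units.mk0 t₀ (left_ne_zero_of_mul ht₀)
  have hspec := hp (Polynomial.aeval (t : K)) (by
    rw [Polynomial.coe_aeval_eq_eval]
    exact right_ne_zero_of_mul ht₀)
  rw [hFmap] at hspec
  simp only [fun a : {a : Fin n →₀ ℕ // a.degree = i + k ∧ a ∈ leadExps (revLex n) I} =>
    map_weightDeform_unit (hf _ a.2.2) (hN a) t] at hspec
  set g := diagGL fun j : Fin n => t ^ N ^ (j : ℕ)
  have hmon : ∀ a : Fin n →₀ ℕ, (((t ^ expWeight N a)⁻¹ : Kˣ) : K) •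
      glAct g (monomial a 1) = monomial a 1 := by
    intro a
    ext b
    rw [coeff_smul, coeff_glAct_diagGL_pow, coeff_monomial]
    split_ifs with hab
    · rw [← hab, mul_one, smul_eq_mul, Units.val_inv_eq_inv_val, Units.val_pow_eq_pow_val,
        inv_mul_cancel₀ (pow_ne_zero _ t.ne_zero)]
    · simp
  have hadapt' := hadapt.smul_glAct g (fun a => (t ^ expWeight N a.1)⁻¹)
    (fun a => (t ^ expWeight N a.1)⁻¹)
  simp only [hmon] at hadapt'
  have hrank := ((hadapt'.maxRankOnForms_iff hl).2 hspec).glAct g⁻¹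
  rw [glIdeal_inv_glIdeal] at hrank
  exact ⟨_, glAct_isHomogeneous _ hl, hrank⟩

end Degeneration

/-! ### The last variable and the reverse lexicographic order -/

section LastVariable

variable {K : Type*} [Field K] {n : ℕ} {I : Ideal (MvPolynomial (Fin (n + 1)) K)}

theorem last_le_of_revLex_le {a b : Fin (n + 1) →₀ ℕ} (hab : b.degree = a.degree)
    (h : (revLex (n + 1)).toSyn b ≤ (revLex (n + 1)).toSyn a) : a (Fin.last n) ≤ b (Fin.last n) := by
  rcases h.lt_or_eq with h | h
  · obtain ⟨i, hi, hlt⟩ := ((revLex_lt_iff.1 h).resolve_left hab.not_lt).2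
    rcases (Fin.le_last i).lt_or_eq with hil | rfl
    · exact (hi _ hil).ge
    · exact hlt.le
  · rw [(revLex (n + 1)).toSyn.injective h]

theorem degree_eq_of_mem_support {d : ℕ} {f : MvPolynomial (Fin n) K} (hf : f.IsHomogeneous d)
    {a : Fin n →₀ ℕ} (ha : a ∈ f.support) : a.degree = d := by
  by_contra h
  exact mem_support_iff.1 ha (hf.coeff_eq_zero h)

theorem isHomogeneous_divMonomial_single {i k : ℕ} {j : Fin n} {f : MvPolynomial (Fin n) K}
    (hf : f.IsHomogeneous (i + k)) : (divMonomial f (Finsupp.single j k)).IsHomogeneous i := by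
  intro a ha
  rw [coeff_divMonomial] at ha
  have := degree_eq_of_mem_support hf (mem_support_iff.2 ha)
  rw [map_add, Finsupp.degree_single] at this
  have h2 := Finsupp.degree_eq_weight_one (R := ℕ) (σ := Fin n)
  have h3 : Finsupp.weight 1 a = a.degree := (DFunLike.congr_fun h2 a).symm
  rw [h3]
  lia

/-- For the reverse lexicographic order, if a power of the last variable has maximal rank modulo
a graded ideal, then so it does modulo the initial ideal. -/
theorem MaxRankOnForms.initialIdeal_X_last
    (hI : I.IsHomogeneous (homogeneousSubmodule (Fin (n + 1)) K)) {k i : ℕ}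
    (h : MaxRankOnForms I (X (Fin.last n)) k i) :
    MaxRankOnForms (initialIdeal (revLex (n + 1)) I) (X (Fin.last n)) k i := by
  classical
  have hXmon : (X (Fin.last n) : MvPolynomial (Fin (n + 1)) K) ^ k =
      monomial (Finsupp.single (Fin.last n) k) 1 := X_pow_eq_monomial
  rw [MaxRankOnForms, hXmon] at h ⊢
  set s : Fin (n + 1) →₀ ℕ := Finsupp.single (Fin.last n) k
  have hs : ∀ b : Fin (n + 1) →₀ ℕ, s ≤ b ↔ k ≤ b (Fin.last n) := fun b =>
    Finsupp.single_le_iff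
  rcases h with h | h
  · refine Or.inl fun f hf hlf => mem_initialIdeal_iff.2 fun a ha => ?_
    have hsa : s + a ∈ leadExps (revLex (n + 1)) I := by
      refine mem_initialIdeal_iff.1 hlf _ (mem_support_iff.2 ?_)
      rw [coeff_monomial_mul, one_mul]
      exact mem_support_iff.1 ha
    obtain ⟨q, hqI, hq⟩ := exists_isMonicForm hI hsa
    -- the leading monomial of `q` is divisible by the power of the last variable, hence so is `q`
    have hmod : modMonomial q s = 0 := by
      ext b
      by_cases hb : s ≤ b
      · rw [coeff_modMonomial_of_le _ hb, coeff_zero]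
      · rw [coeff_modMonomial_of_not_le _ hb, coeff_zero]
        by_contra hne
        have hb' := mem_support_iff.2 hne
        have := last_le_of_revLex_le (degree_eq_of_mem_support hq.isHomogeneous hb') (hq.le b hb')
        rw [Finsupp.add_apply] at this
        have hsl : s (Fin.last n) = k := Finsupp.single_eq_same
        exact hb ((hs b).2 (by lia))
    have hdiv := divMonomial_add_modMonomial q s
    rw [hmod, add_zero] at hdiv
    have hadeg : (s + a).degree = i + k := by
      rw [map_add, degree_eq_of_mem_support hf ha, Finsupp.degree_single, add_comm]
    have hhom := hq.isHomogeneous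
    rw [hadeg] at hhom
    refine mem_leadExps_of_forall_le (f := divMonomial q s)
      (h _ (isHomogeneous_divMonomial_single hhom) (by rwa [hdiv])) ?_ fun b hb => ?_
    · rw [coeff_divMonomial, hq.coeff_eq]
      exact one_ne_zero
    · rw [mem_support_iff, coeff_divMonomial] at hb
      have := hq.le _ (mem_support_iff.2 hb)
      rw [map_add, map_add] at this
      exact le_of_add_le_add_left this
  · refine Or.inr fun f hf => ⟨divMonomial f s, isHomogeneous_divMonomial_single hf, ?_⟩
    have hsub : f - monomial s 1 * (divMonomial f s) = modMonomial f s := by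
      conv_lhs => lhs; rw [← divMonomial_add_modMonomial f s]
      rw [add_sub_cancel_left]
    rw [hsub]
    refine mem_initialIdeal_iff.2 fun a ha => ?_
    have hsa : ¬ s ≤ a := fun hsa =>
      mem_support_iff.1 ha (coeff_modMonomial_of_le f hsa)
    rw [mem_support_iff, coeff_modMonomial_of_not_le _ hsa] at ha
    have hadeg := degree_eq_of_mem_support hf (mem_support_iff.2 ha)
    obtain ⟨q, hq, hqI⟩ := h (monomial a 1) (isHomogeneous_monomial _ hadeg)
    -- `x ^ a` is not divisible by the power of the last variable, so it is larger than every
    -- monomial of `monomial s 1 * q`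
    have hcoeff : ∀ b, ¬ s ≤ b → coeff b (monomial s 1 * q) = 0 := fun b hb => by
      rw [coeff_monomial_mul', if_neg hb]
    refine mem_leadExps_of_forall_le hqI ?_ fun b hb => ?_
    · rw [coeff_sub, hcoeff a hsa, coeff_monomial, if_pos rfl, sub_zero]
      exact one_ne_zero
    · by_cases hba : b = a
      · rw [hba]
      · have hsb : s ≤ b := by
          by_contra hsb
          rw [mem_support_iff, coeff_sub, hcoeff b hsb, coeff_monomial,
            if_neg (Ne.symm hba), sub_zero] at hb
          exact hb rfl
        have hmul : (monomial s (1 : K) * q).IsHomogeneous (i + k) := by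
          have := (isHomogeneous_monomial (1 : K) (Finsupp.degree_single (Fin.last n) k)).mul hq
          rwa [add_comm k i] at this
        have hbdeg := degree_eq_of_mem_support
          ((isHomogeneous_monomial (1 : K) hadeg).sub hmul) hb
        refine le_of_not_gt fun hlt => hsa ((hs a).2 (((hs b).1 hsb).trans ?_))
        exact last_le_of_revLex_le (hadeg.trans hbdeg.symm) hlt.le

end LastVariable

/-! ### Generic linear forms -/

section Generic

variable {K : Type*} [Field K] {n : ℕ} {I J : Ideal (MvPolynomial (Fin n) K)}

theorem exists_eq_sum_C_mul_X {l : MvPolynomial (Fin n) K} (hl : l.IsHomogeneous 1) :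
    ∃ c : Fin n → K, l = ∑ i, C (c i) * X i := by
  have h : l ∈ homogeneousSubmodule (Fin n) K 1 := hl
  rw [homogeneousSubmodule_one_eq_span_X] at h
  obtain ⟨c, rfl⟩ := (Submodule.mem_span_range_iff_exists_fun K).1 h
  exact ⟨c, Finset.sum_congr rfl fun i _ => smul_eq_C_mul _ _⟩

theorem isHomogeneous_sum_C_mul_X {R : Type*} [CommRing R] (c : Fin n → R) :
    (∑ i, C (c i) * X i).IsHomogeneous 1 :=
  IsHomogeneous.sum _ _ _ fun _ _ => isHomogeneous_C_mul_X _ _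

theorem glAct_sum_C_mul_X (g : GL (Fin n) K) (c : Fin n → K) :
    glAct g (∑ i, C (c i) * X i) = ∑ j, C (g.val.mulVec c j) * X j := by
  simp only [glAct, map_sum, map_mul, algHom_C, algebraMap_eq, aeval_X, Finset.mul_sum,
    Matrix.mulVec, dotProduct, Finset.sum_mul]
  rw [Finset.sum_comm]
  exact Finset.sum_congr rfl fun i _ => Finset.sum_congr rfl fun j _ => by ring

theorem exists_forall_isHomogeneous_mem (hrad : I.radical = idealOfVars (Fin n) K) :
    ∃ D, ∀ d, D ≤ d → ∀ f : MvPolynomial (Fin n) K, f.IsHomogeneous d → f ∈ I := by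
  obtain ⟨D, hD⟩ := Ideal.exists_pow_le_of_le_radical_of_fg hrad.ge (idealOfVars_fg (Fin n) K)
  refine ⟨D, fun d hd f hf => hD ((mem_pow_idealOfVars_iff D f).2 fun a ha => ?_)⟩
  rwa [degree_eq_of_mem_support hf ha]

theorem exists_eval_ne_zero [Infinite K] {τ : Type*} {p : MvPolynomial τ K} (hp : p ≠ 0) :
    ∃ x, eval x p ≠ 0 := by
  by_contra! h
  exact hp (MvPolynomial.funext fun x => by rw [h, map_zero])

/-- For a family of linear forms with polynomial coefficients, maximal rank in every pair of degrees
in a given set holds generically, provided that for each pair separately it holds somewhere: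
only finitely many pairs matter, since `I` contains all forms of large degree. -/
theorem exists_ne_zero_forall_maxRankOnForms {τ : Type*}
    (hI : I.IsHomogeneous (homogeneousSubmodule (Fin n) K))
    (hrad : I.radical = idealOfVars (Fin n) K)
    {l : MvPolynomial (Fin n) (MvPolynomial τ K)} (hl : l.IsHomogeneous 1) {P : ℕ → ℕ → Prop}
    (h : ∀ i k, P i k → ∃ x : τ → K, MaxRankOnForms I (map (eval x) l) k i) :
    ∃ p : MvPolynomial τ K, p ≠ 0 ∧
      ∀ x, eval x p ≠ 0 → ∀ i k, P i k → MaxRankOnForms I (map (eval x) l) k i := by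
  classical
  obtain ⟨D, hD⟩ := exists_forall_isHomogeneous_mem hrad
  choose! f hfI hf using fun a (ha : a ∈ leadExps (revLex n) I) => exists_isMonicForm hI ha
  have key : ∀ i k, ∃ p : MvPolynomial τ K, p ≠ 0 ∧
      ∀ x, eval x p ≠ 0 → P i k → MaxRankOnForms I (map (eval x) l) k i := by
    intro i k
    by_cases hP : P i k
    · obtain ⟨x₀, hx₀⟩ := h i k hP
      obtain ⟨p, hp, hp'⟩ := (isAdapted_of_isMonicForm rfl i (i + k) hfI
        hf).exists_forall_maxRankOnForms hl (aeval x₀) (by rwa [coe_aeval_eq_eval])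
      refine ⟨p, ?_, fun x hx _ => ?_⟩
      · rintro rfl
        exact hp (map_zero _)
      · have := hp' (aeval x) (by rwa [aeval_eq_eval])
        rwa [coe_aeval_eq_eval] at this
    · exact ⟨1, one_ne_zero, fun _ _ hP' => absurd hP' hP⟩
  choose p hp0 hp using key
  refine ⟨∏ i ∈ Finset.range D, ∏ k ∈ Finset.range D, p i k,
    Finset.prod_ne_zero_iff.2 fun i _ => Finset.prod_ne_zero_iff.2 fun k _ => hp0 i k,
    fun x hx i k hik => ?_⟩
  by_cases hlarge : D ≤ i + k
  · refine Or.inr fun f hf => ⟨0, isHomogeneous_zero _ _ _, ?_⟩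
    rw [mul_zero, sub_zero]
    exact hD _ hlarge f hf
  · rw [map_prod, Finset.prod_ne_zero_iff] at hx
    have hx' := hx i (Finset.mem_range.2 (by lia))
    rw [map_prod, Finset.prod_ne_zero_iff] at hx'
    exact hp i k x (hx' k (Finset.mem_range.2 (by lia))) hik

/-- Maximal rank modulo the generic initial ideal passes to `I`: degenerating one pair of degrees at
a time gives linear forms that depend on the pair, and a generic linear form serves for all. -/
theorem exists_forall_maxRankOnForms_of_isGenericInitialIdeal [Infinite K]
    (hI : I.IsHomogeneous (homogeneousSubmodule (Fin n) K))
    (hrad : I.radical = idealOfVars (Fin n) K)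
    (hJ : IsGenericInitialIdeal (revLex n) I J) {P : ℕ → ℕ → Prop}
    {l : MvPolynomial (Fin n) K} (hl : l.IsHomogeneous 1)
    (h : ∀ i k, P i k → MaxRankOnForms J l k i) :
    ∃ l' : MvPolynomial (Fin n) K, l'.IsHomogeneous 1 ∧
      ∀ i k, P i k → MaxRankOnForms I l' k i := by
  obtain ⟨U, -, ⟨g, hg⟩, hU⟩ := hJ
  have hsep : ∀ i k, P i k → ∃ x : Fin n → K,
      MaxRankOnForms I (map (eval x) (∑ j, C (X j) * X j)) k i := by
    intro i k hik
    have hik' := h i k hik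
    rw [← hU g hg] at hik'
    obtain ⟨l', hl', hrank⟩ :=
      exists_maxRankOnForms_of_initialIdeal (isHomogeneous_glIdeal hI g) hl hik'
    have hrank' := hrank.glAct g⁻¹
    rw [glIdeal_inv_glIdeal] at hrank'
    obtain ⟨c, hc⟩ := exists_eq_sum_C_mul_X (glAct_isHomogeneous g⁻¹ hl')
    refine ⟨c, ?_⟩
    rw [hc] at hrank'
    simpa using hrank'
  obtain ⟨p, hp0, hp⟩ :=
    exists_ne_zero_forall_maxRankOnForms hI hrad (isHomogeneous_sum_C_mul_X _) hsep
  obtain ⟨x, hx⟩ := exists_eval_ne_zero hp0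
  exact ⟨_, (isHomogeneous_sum_C_mul_X _).map _, hp x hx⟩

end Generic

section LastVariableGeneric

variable {K : Type*} [Field K] [Infinite K] {n : ℕ} {I J : Ideal (MvPolynomial (Fin (n + 1)) K)}

/-- If a linear form has maximal rank modulo `I` in a set of degrees, then so has the last variable
modulo the generic initial ideal. -/
theorem maxRankOnForms_X_last_of_isGenericInitialIdeal
    (hI : I.IsHomogeneous (homogeneousSubmodule (Fin (n + 1)) K))
    (hrad : I.radical = idealOfVars (Fin (n + 1)) K)
    (hJ : IsGenericInitialIdeal (revLex (n + 1)) I J) {P : ℕ → ℕ → Prop}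
    {l : MvPolynomial (Fin (n + 1)) K} (hl : l.IsHomogeneous 1)
    (h : ∀ i k, P i k → MaxRankOnForms I l k i) :
    ∀ i k, P i k → MaxRankOnForms J (X (Fin.last n)) k i := by
  obtain ⟨U, ⟨S, hS⟩, ⟨g₁, hg₁⟩, hU⟩ := hJ
  obtain ⟨q, hqS, hq⟩ := (hS g₁).1 hg₁
  have hq0 : q ≠ 0 := by
    rintro rfl
    exact hq (map_zero _)
  -- `l` itself may vanish, or miss the last variable; a generic linear form does not
  obtain ⟨c, hcn, hc⟩ : ∃ c : Fin (n + 1) → K, c (Fin.last n) ≠ 0 ∧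
      ∀ i k, P i k → MaxRankOnForms I (∑ j, C (c j) * X j) k i := by
    obtain ⟨c₀, rfl⟩ := exists_eq_sum_C_mul_X hl
    obtain ⟨p, hp0, hp⟩ := exists_ne_zero_forall_maxRankOnForms (τ := Fin (n + 1)) hI hrad
      (isHomogeneous_sum_C_mul_X X) (P := P) fun i k hik => ⟨c₀, by simpa using h i k hik⟩
    obtain ⟨c, hc⟩ := exists_eval_ne_zero (mul_ne_zero hp0 (X_ne_zero (R := K) (Fin.last n)))
    rw [map_mul, eval_X] at hc
    exact ⟨c, right_ne_zero_of_mul hc, fun i k hik => by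
      simpa using hp c (left_ne_zero_of_mul hc) i k hik⟩
  -- the linear form that `g` maps to a multiple of the last variable, with coefficients that are
  -- polynomial in the entries of `g`
  set A : Matrix (Fin (n + 1)) (Fin (n + 1)) (MvPolynomial (Fin (n + 1) × Fin (n + 1)) K) :=
    Matrix.mvPolynomialX (Fin (n + 1)) (Fin (n + 1)) K
  have hA : ∀ M : Matrix (Fin (n + 1)) (Fin (n + 1)) K,
      (eval fun ij : Fin (n + 1) × Fin (n + 1) => M ij.1 ij.2).mapMatrix A = M := by
    intro M
    ext i j
    simp [A, Matrix.mvPolynomialX]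
  have hmap : ∀ M : Matrix (Fin (n + 1)) (Fin (n + 1)) K,
      map (eval fun ij : Fin (n + 1) × Fin (n + 1) => M ij.1 ij.2)
        (∑ j, C (A.adjugate j (Fin.last n)) * X j) =
      ∑ j, C (M.adjugate j (Fin.last n)) * X j := by
    intro M
    have := RingHom.map_adjugate (eval fun ij : Fin (n + 1) × Fin (n + 1) => M ij.1 ij.2) A
    rw [hA] at this
    simp [← this]
  -- the inverse of the identity matrix with last column `c` maps `∑ j, c j x_j` to the last variable
  set H : Matrix (Fin (n + 1)) (Fin (n + 1)) K := (1 : Matrix _ _ K).updateCol (Fin.last n) c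
  have hHdet : H.det = c (Fin.last n) := by
    have := DFunLike.congr_fun (Matrix.cramer_one (n := Fin (n + 1)) (α := K)) c
    rw [← Matrix.cramer_apply, this]
    rfl
  obtain ⟨p, hp0, hp⟩ := exists_ne_zero_forall_maxRankOnForms hI hrad
    (isHomogeneous_sum_C_mul_X fun j => A.adjugate j (Fin.last n)) (P := P) fun i k hik => by
      refine ⟨fun ij => H⁻¹ ij.1 ij.2, ?_⟩
      have hdet : H⁻¹.det ≠ 0 := by
        rw [Matrix.det_nonsing_inv, Ring.inverse_eq_inv', hHdet]
        exact inv_ne_zero hcn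
      have hadj : H⁻¹.adjugate = H⁻¹.det • H := by
        have hunit : IsUnit H.det := by
          rw [hHdet]
          exact hcn.isUnit
        have h1 := Matrix.mul_adjugate H⁻¹
        calc H⁻¹.adjugate = H * (H⁻¹ * H⁻¹.adjugate) := by
              rw [← Matrix.mul_assoc, Matrix.mul_nonsing_inv _ hunit, Matrix.one_mul]
          _ = H⁻¹.det • H := by rw [h1, Matrix.mul_smul, Matrix.mul_one]
      rw [hmap, hadj]
      have := (hc i k hik).smul hdet
      simpa [H, Finset.smul_sum, smul_eq_C_mul, mul_assoc] using this
  obtain ⟨x, hx⟩ := exists_eval_ne_zero (mul_ne_zero (mul_ne_zero hp0 hq0)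
    (Matrix.det_mvPolynomialX_ne_zero (Fin (n + 1)) K))
  obtain ⟨M, rfl⟩ : ∃ M : Matrix (Fin (n + 1)) (Fin (n + 1)) K, x = fun ij => M ij.1 ij.2 :=
    ⟨Matrix.of fun i j => x (i, j), rfl⟩
  rw [map_mul, map_mul, RingHom.map_det, hA] at hx
  set g : GL (Fin (n + 1)) K :=
    Matrix.GeneralLinearGroup.mkOfDetNeZero M (right_ne_zero_of_mul hx)
  have hg : g ∈ U := (hS g).2 ⟨q, hqS, right_ne_zero_of_mul (left_ne_zero_of_mul hx)⟩
  intro i k hik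
  have hrank := (hp _ (left_ne_zero_of_mul (left_ne_zero_of_mul hx)) i k hik).glAct g
  rw [hmap, glAct_sum_C_mul_X] at hrank
  have hlast : ∑ j, C (g.val.mulVec (fun j => M.adjugate j (Fin.last n)) j) * X j =
      M.det • (X (Fin.last n) : MvPolynomial (Fin (n + 1)) K) := by
    have hcol : g.val.mulVec (fun j => M.adjugate j (Fin.last n)) =
        fun j => (M * M.adjugate) j (Fin.last n) := rfl
    rw [hcol, Matrix.mul_adjugate, Finset.sum_eq_single (Fin.last n)]
    · simp [smul_eq_C_mul]
    · intro j _ hj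
      simp [Matrix.one_apply_ne hj]
    · simp
  rw [hlast] at hrank
  have hrank' := hrank.smul (inv_ne_zero (right_ne_zero_of_mul hx))
  rw [smul_smul, inv_mul_cancel₀ (right_ne_zero_of_mul hx), one_smul] at hrank'
  rw [← hU g hg]
  exact hrank'.initialIdeal_X_last (isHomogeneous_glIdeal hI g)

end LastVariableGeneric

/-- The set of pairs of degrees on which maximal rank is required is arbitrary, so that the weak and
the strong Lefschetz property are both covered. -/
theorem exists_forall_maxRankOnForms_iff {K : Type*} [Field K] [Infinite K] {n : ℕ}
    {I J : Ideal (MvPolynomial (Fin n) K)}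
    (hI : I.IsHomogeneous (homogeneousSubmodule (Fin n) K))
    (hrad : I.radical = idealOfVars (Fin n) K)
    (hJ : IsGenericInitialIdeal (revLex n) I J) (P : ℕ → ℕ → Prop) :
    (∃ l : MvPolynomial (Fin n) K, l.IsHomogeneous 1 ∧
        ∀ i k, P i k → MaxRankOnForms I l k i) ↔
      ∃ l : MvPolynomial (Fin n) K, l.IsHomogeneous 1 ∧
        ∀ i k, P i k → MaxRankOnForms J l k i := by
  constructor
  · rintro ⟨l, hl, h⟩
    rcases n with - | n
    · -- without variables, both ideals vanish
      have hI0 : I = ⊥ := le_bot_iff.1 (I.le_radical.trans (by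
        rw [hrad, idealOfVars, Set.range_eq_empty, Ideal.span_empty]))
      have hJ0 : J = ⊥ := by
        obtain ⟨U, -, ⟨g, hg⟩, hU⟩ := hJ
        rw [← hU g hg, hI0, glIdeal, Ideal.map_bot, initialIdeal]
        simp
      rw [hJ0, ← hI0]
      exact ⟨l, hl, h⟩
    · exact ⟨X (Fin.last n), isHomogeneous_X _ _,
        maxRankOnForms_X_last_of_isGenericInitialIdeal hI hrad hJ hl h⟩
  · rintro ⟨l, hl, h⟩
    exact exists_forall_maxRankOnForms_of_isGenericInitialIdeal hI hrad hJ hl h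

end GinLefschetz

theorem proposition2p8 {K : Type*} [Field K] [Infinite K] {n : ℕ}
    (I J : Ideal (MvPolynomial (Fin n) K))
    (hI : I.IsHomogeneous (MvPolynomial.homogeneousSubmodule (Fin n) K))
    (hprim : I.IsPrimary) (hrad : I.radical = MvPolynomial.idealOfVars (Fin n) K)
    (hJ : GinLefschetz.IsGenericInitialIdeal (GinLefschetz.revLex n) I J) :
    (GinLefschetz.HasWeakLefschetz I ↔ GinLefschetz.HasWeakLefschetz J) ∧
      (GinLefschetz.HasStrongLefschetz I ↔ GinLefschetz.HasStrongLefschetz J) := by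
  have hweak : ∀ I' : Ideal (MvPolynomial (Fin n) K), GinLefschetz.HasWeakLefschetz I' ↔
      ∃ l ∈ GinLefschetz.quotientComponent I' 1, ∀ i k : ℕ, k = 1 →
        GinLefschetz.MulPowHasMaxRank I' l k i := fun I' => by
    simp only [GinLefschetz.HasWeakLefschetz, forall_eq]
  refine ⟨?_, ?_⟩
  · rw [hweak, hweak, GinLefschetz.exists_mem_quotientComponent_one_iff (P := fun _ k => k = 1),
      GinLefschetz.exists_mem_quotientComponent_one_iff (P := fun _ k => k = 1)]
    exact GinLefschetz.exists_forall_maxRankOnForms_iff hI hrad hJ _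
  · rw [GinLefschetz.HasStrongLefschetz, GinLefschetz.HasStrongLefschetz,
      GinLefschetz.exists_mem_quotientComponent_one_iff (P := fun _ k => 1 ≤ k),
      GinLefschetz.exists_mem_quotientComponent_one_iff (P := fun _ k => 1 ≤ k)]
    exact GinLefschetz.exists_forall_maxRankOnForms_iff hI hrad hJ _
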